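/- Let $\Bbbk$ be a field of odd prime characteristic $p$, and let $d\ge 0$ and $r\ge 1$ be integers. Let $\mathcal P_d$ be the category of homogeneous strict polynomial functors of degree $d$: its objects are the $\Bbbk$-linear functors to finite-dimensional vector spaces from the category whose objects are the finite-dimensional vector spaces and whose morphism spaces are $\Gamma^d\mathrm{Hom}(V,W)=\mathrm{Hom}_{\mathfrak S_d}(V^{\otimes d},W^{\otimes d})$, and its morphisms are the natural transformations. Let $\mathbf P_{D}$ be the category of homogeneous strict polynomial superfunctors of degree $D$: its objects are the even $\Bbbk$-linear functors to finite-dimensional super vector spaces from the category whose objects are the finite-dimensional super vector spaces and whose morphism spaces are $\boldsymbol\Gamma^{D}\mathrm{Hom}(V,W)=\mathrm{Hom}_{\mathfrak S_{D}}(V^{\otimes D},W^{\otimes D})$ for the signed action of $\mathfrak S_{D}$. The morphism spaces of $\mathbf P_D$ are $\mathrm{Hom}(F,G)=\mathrm{Hom}(F,G)_0\oplus\mathrm{Hom}(F,G)_1$, where $\mathrm{Hom}(F,G)_a$ consists of the families of linear maps $\eta_V:F(V)\to G(V)$ of parity $a$ with $G(f)\circ\eta_V=(-1)^{ab}\,\eta_W\circ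 F(f)$ for all $f\in\boldsymbol\Gamma^{D}\mathrm{Hom}(V,W)$ of parity $b$. Write $V^{(r)}=V\otimes_\varphi\Bbbk$ for the base change of a vector space $V$ along $\varphi:x\mapsto x^{p^r}$. For $F\in\mathcal P_d$ let $F_0^{(r)}=F\circ\mathbf I_0^{(r)}\in\mathbf P_{dp^r}$ be the superfunctor $V\mapsto F(V_0^{(r)})$ with purely even values, where morphisms act through the map $\boldsymbol\Gamma^{dp^r}\mathrm{Hom}(V,W)\to\Gamma^d\mathrm{Hom}(V_0^{(r)},W_0^{(r)})$ sending $f$ to the map $\tilde f$ determined by $$\big\langle \xi_1^{(r)}\otimes\cdots\otimes\xi_d^{(r)},\ \tilde f(v_1^{(r)}\otimes\cdots\otimes v_d^{(r)})\big\rangle=\big\langle \xi_1^{\otimes p^r}\otimes\cdots\otimes\xi_d^{\otimes p^r},\ f(v_1^{\otimes p^r}\otimes\cdots\otimes v_d^{\otimes p^r})\big\rangle$$ for $v_i\in V_0$ and linear forms $\xi_i$ on $W_0$, extended by zero to $W$. For a finite-dimensional vector space $V$ let $\Gamma^{d,V}=\Gamma^d\mathrm{Hom}(V,-)\in\mathcal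 P_d$. Then the functor $-\circ\mathbf I_0^{(r)}:\mathcal P_d\to\mathbf P_{dp^r}$, $F\mapsto F_0^{(r)}$, is exact (it sends sequences that are exact at every $V$ to such sequences), and it has a right adjoint $\rho:\mathbf P_{dp^r}\to\mathcal P_d$, which is given by $$\rho(G)(V)\;\cong\;\mathrm{Hom}_{\mathbf P_{dp^r}}\big((\Gamma^{d,V})_0^{(r)},\,G\big),$$ the right-hand side being regarded as a vector space by forgetting the $\mathbb Z/2$-grading. These linear isomorphisms are natural in $G$ and in $V$; here naturality in $V$ is as strict polynomial functors, $f\in\Gamma^d\mathrm{Hom}(V,W)$ acting on the right-hand side by precomposition with the twist of the transformation $\Gamma^{d,W}\to\Gamma^{d,V}$ that it induces. -/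

import Mathlib

universe u
open scoped TensorProduct
open CategoryTheory

namespace StrictPoly

theorem sum_eq_sum_fixedPoints {p : ℕ} [Fact p.Prime] {R : Type*} [CommRing R] [CharP R p]
    {G Ω : Type*} [Group G] [MulAction G Ω] [Fintype Ω] (hG : IsPGroup p G)
    (f : Ω → R) (hf : ∀ (g : G) (w : Ω), f (g • w) = f w)
    [DecidablePred fun w : Ω => w ∈ MulAction.fixedPoints G Ω] :
    ∑ w, f w = ∑ w with w ∈ MulAction.fixedPoints G Ω, f w := by
  classical
  rw [← Finset.sum_fiberwise_of_maps_to (s := Finset.univ) (t := Finset.univ.image f) (g := f)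
      (fun x _ => Finset.mem_image_of_mem f (Finset.mem_univ x)),
    ← Finset.sum_fiberwise_of_maps_to (s := Finset.univ.filter _) (t := Finset.univ.image f)
      (g := f) (fun x _ => Finset.mem_image_of_mem f (Finset.mem_univ x))]
  refine Finset.sum_congr rfl fun c _ => ?_
  rw [Finset.sum_congr rfl (fun x hx => (Finset.mem_filter.1 hx).2),
    Finset.sum_congr (s₁ := Finset.filter _ (Finset.filter _ _)) rfl
      (fun x hx => (Finset.mem_filter.1 hx).2), Finset.sum_const, Finset.sum_const,
    nsmul_eq_mul, nsmul_eq_mul]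
  congr 1
  let A : SubMulAction G Ω := ⟨{w | f w = c}, fun g w hw => by
    change f (g • w) = c
    rw [hf]; exact hw⟩
  have key := hG.card_modEq_card_fixedPoints A
  have h1 : Nat.card A = (Finset.univ.filter fun w => f w = c).card := by
    rw [← Fintype.card_subtype, ← Nat.card_eq_fintype_card]
    rfl
  have h2 : Nat.card (MulAction.fixedPoints G A) =
      ((Finset.univ.filter fun w => w ∈ MulAction.fixedPoints G Ω).filter
        fun w => f w = c).card := by
    rw [Finset.filter_filter, ← Fintype.card_subtype, ← Nat.card_eq_fintype_card]
    refine Nat.card_congr ⟨fun a => ⟨a.1.1, fun g => congrArg Subtype.val (a.2 g), a.1.2⟩,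
      fun w => ⟨⟨w.1, w.2.2⟩, fun g => Subtype.ext (w.2.1 g)⟩, fun _ => rfl, fun _ => rfl⟩
  rw [h1, h2] at key
  exact (CharP.natCast_eq_natCast R p).2 key

theorem sum_words {p : ℕ} [Fact p.Prime] {R : Type*} [CommRing R] [CharP R p] (d r : ℕ)
    {X : Type*} [Fintype X] (f : (Fin (d * p ^ r) → X) → R)
    (hf : ∀ σ : Equiv.Perm (Fin (d * p ^ r)), (∀ t, (σ t).divNat = t.divNat) →
      ∀ w, f (w ∘ σ) = f w) :
    ∑ w, f w = ∑ I : Fin d → X, f (I ∘ Fin.divNat) := by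
  classical
  have hq : 0 < p ^ r := pow_pos (Fact.out : p.Prime).pos r
  have : NeZero (p ^ r) := ⟨hq.ne'⟩
  let e : Fin (d * p ^ r) ≃ Fin d × ZMod (p ^ r) :=
    finProdFinEquiv.symm.trans (Equiv.prodCongr (Equiv.refl _) (ZMod.finEquiv (p ^ r)).toEquiv)
  have he : ∀ t, (e t).1 = t.divNat := fun t => rfl
  have he' : ∀ x, (e.symm x).divNat = x.1 := fun x => by rw [← he, e.apply_symm_apply]
  let rot : (Fin d → ZMod (p ^ r)) → Equiv.Perm (Fin (d * p ^ r)) := fun g =>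
    { toFun := fun t => e.symm ((e t).1, (e t).2 + g (e t).1)
      invFun := fun t => e.symm ((e t).1, (e t).2 - g (e t).1)
      left_inv := fun t => by simp
      right_inv := fun t => by simp }
  let _ : MulAction (Multiplicative (Fin d → ZMod (p ^ r))) (Fin (d * p ^ r) → X) :=
    { smul := fun g w => w ∘ rot g.toAdd
      one_smul := fun w => by
        funext t
        change w (e.symm ((e t).1, (e t).2 + 0)) = w t
        simp
      mul_smul := fun g h w => by
        funext t
        change w (e.symm ((e t).1, (e t).2 + (g.toAdd (e t).1 + h.toAdd (e t).1))) =
          w (e.symm ((e (e.symm ((e t).1, (e t).2 + g.toAdd (e t).1))).1,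
            (e (e.symm ((e t).1, (e t).2 + g.toAdd (e t).1))).2 +
              h.toAdd (e (e.symm ((e t).1, (e t).2 + g.toAdd (e t).1))).1))
        simp [add_assoc] }
  have hsmul : ∀ (g : Multiplicative (Fin d → ZMod (p ^ r))) (w : Fin (d * p ^ r) → X) t,
      (g • w) t = w (e.symm ((e t).1, (e t).2 + g.toAdd (e t).1)) := fun _ _ _ => rfl
  have hG : IsPGroup p (Multiplicative (Fin d → ZMod (p ^ r))) :=
    IsPGroup.of_card (n := r * d) (by simp [Nat.card_eq_fintype_card, ZMod.card, pow_mul])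
  rw [sum_eq_sum_fixedPoints hG f (fun g w => hf (rot g.toAdd) (fun t => by
    rw [← he, ← he]; change (e (e.symm _)).1 = _; simp) w)]
  symm
  refine Finset.sum_bij (fun I _ => I ∘ Fin.divNat) ?_ ?_ ?_ (fun _ _ => rfl)
  · intro I _
    refine Finset.mem_filter.2 ⟨Finset.mem_univ _, fun g => ?_⟩
    funext t
    rw [hsmul]
    simp [he', he]
  · intro I _ J _ h
    funext i
    have := congrFun h (e.symm (i, 0))
    simpa [he'] using this
  · intro w hw
    have hw := (Finset.mem_filter.1 hw).2
    refine ⟨fun i => w (e.symm (i, 0)), Finset.mem_univ _, ?_⟩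
    funext t
    have := congrFun (hw (Multiplicative.ofAdd fun _ => - (e t).2)) t
    rw [hsmul] at this
    simpa [he] using this


/-! ### Super vector spaces -/

/-- A finite-dimensional super vector space `V = V₀ ⊕ V₁` over `k`. -/
structure SuperSpace (k : Type u) [Field k] where
  carrier : Type u
  [addCommGroup : AddCommGroup carrier]
  [module : Module k carrier]
  [finite : Module.Finite k carrier]
  grade : ZMod 2 → Submodule k carrier
  isCompl : IsCompl (grade 0) (grade 1)

namespace SuperSpace

instance (k : Type u) [Field k] : CoeSort (SuperSpace k) (Type u) := ⟨carrier⟩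

attribute [instance] addCommGroup module finite

end SuperSpace

section LinearAlgebra

variable {k : Type u} [Field k]

/-- The projection of `V = V₀ ⊕ V₁` onto its homogeneous component `V_a`. -/
noncomputable def SuperSpace.proj (V : SuperSpace k) (a : ZMod 2) : V →ₗ[k] V :=
  if a = 0 then (V.grade 0).projection (V.grade 1) V.isCompl
  else (V.grade 1).projection (V.grade 0) V.isCompl.symm

/-- A linear map `f` between `ℤ/2`-graded spaces `M = M₀ ⊕ M₁` and `N = N₀ ⊕ N₁` is homogeneous
of parity `a` if `f(M_b) ⊆ N_{b+a}` for all `b`. -/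
def IsHomogeneous {M N : Type*} [AddCommGroup M] [Module k M] [AddCommGroup N] [Module k N]
    (gM : ZMod 2 → Submodule k M) (gN : ZMod 2 → Submodule k N) (a : ZMod 2)
    (f : M →ₗ[k] N) : Prop :=
  ∀ b, ∀ x ∈ gM b, f x ∈ gN (b + a)

/-- The sign `(-1)^{ab}` of the Koszul rule. -/
def koszul (k : Type u) [Field k] (a b : ZMod 2) : k := (-1) ^ (a.val * b.val)

/-- The sign acquired when the homogeneous tensor `v₁ ⊗ ⋯ ⊗ v_n`, with `v_i` of parity `ε i`, is
permuted by `σ`: the product of the signs `(-1)^{ε i ε j}` over all inversions of `σ`. -/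
def permSign (k : Type u) [Field k] {n : ℕ} (σ : Equiv.Perm (Fin n)) (ε : Fin n → ZMod 2) : k :=
  ∏ x : Fin n × Fin n with x.1 < x.2 ∧ σ x.2 < σ x.1, koszul k (ε x.1) (ε x.2)

/-- The `n`-th tensor power `V^{⊗n}`. -/
abbrev TPow (k : Type u) [Field k] (n : ℕ) (V : Type u) [AddCommGroup V] [Module k V] : Type u :=
  ⨂[k] _ : Fin n, V

/-- The action of a permutation on `V^{⊗n}` for a vector space `V` (no signs); it moves the `i`-th
factor to the place `σ i`. -/
noncomputable def perm (n : ℕ) (V : Type u) [AddCommGroup V] [Module k V]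
    (σ : Equiv.Perm (Fin n)) : TPow k n V →ₗ[k] TPow k n V :=
  (PiTensorProduct.reindex k (fun _ : Fin n => V) σ).toLinearMap

/-- The signed action of a permutation on `V^{⊗n}` for a super vector space `V`. The sum over `ε`
splits a tensor into components whose `i`-th factor has parity `ε i`. -/
noncomputable def superPerm (n : ℕ) (V : SuperSpace k) (σ : Equiv.Perm (Fin n)) :
    TPow k n V →ₗ[k] TPow k n V :=
  ∑ ε : Fin n → ZMod 2,
    permSign k σ ε • (perm n V σ ∘ₗ PiTensorProduct.map (fun i => V.proj (ε i)))

/-- The homogeneous components of `V^{⊗n}` for a super vector space `V`: the component of parity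
`a` is spanned by the tensors `v₁ ⊗ ⋯ ⊗ v_n` with `v_i` homogeneous of parity `ε i` and
`∑ ε i = a`. -/
def tensorGrade (n : ℕ) (V : SuperSpace k) (a : ZMod 2) : Submodule k (TPow k n V) :=
  Submodule.span k {t | ∃ (ε : Fin n → ZMod 2) (v : Fin n → V),
    (∀ i, v i ∈ V.grade (ε i)) ∧ ∑ i, ε i = a ∧ t = PiTensorProduct.tprod k v}

/-! ### The categories of divided powers -/

/-- `Γ^n Hom(V, W)`, the space of morphisms from `V` to `W` in the `n`-th divided power of the
category of vector spaces. The symmetric tensors in `Hom(V, W)^{⊗n} = Hom(V^{⊗n}, W^{⊗n})` are the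
`S_n`-equivariant maps `V^{⊗n} → W^{⊗n}`, and composition is the composition of such maps. -/
noncomputable def GammaHom (k : Type u) [Field k] (n : ℕ) (V W : Type u) [AddCommGroup V] [Module k V]
    [AddCommGroup W] [Module k W] : Submodule k (TPow k n V →ₗ[k] TPow k n W) where
  carrier := {f | ∀ σ, perm n W σ ∘ₗ f = f ∘ₗ perm n V σ}
  add_mem' hf hg σ := by
    rw [LinearMap.comp_add, LinearMap.add_comp, hf σ, hg σ]
  zero_mem' σ := by rw [LinearMap.comp_zero, LinearMap.zero_comp]
  smul_mem' c f hf σ := by rw [LinearMap.comp_smul, LinearMap.smul_comp, hf σ]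

/-- The super version of `Γ^n Hom(V, W)`: the tensors in `Hom(V, W)^{⊗n} = Hom(V^{⊗n}, W^{⊗n})`
invariant under the signed action of `S_n` are the linear maps (of any parity) `V^{⊗n} → W^{⊗n}`
that commute with the signed actions. -/
noncomputable def SuperGammaHom (n : ℕ) (V W : SuperSpace k) :
    Submodule k (TPow k n V →ₗ[k] TPow k n W) where
  carrier := {f | ∀ σ, superPerm n W σ ∘ₗ f = f ∘ₗ superPerm n V σ}
  add_mem' hf hg σ := by
    rw [LinearMap.comp_add, LinearMap.add_comp, hf σ, hg σ]
  zero_mem' σ := by rw [LinearMap.comp_zero, LinearMap.zero_comp]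
  smul_mem' c f hf σ := by rw [LinearMap.comp_smul, LinearMap.smul_comp, hf σ]

namespace GammaHom

variable {n : ℕ} {U V W : Type u} [AddCommGroup U] [Module k U] [AddCommGroup V] [Module k V]
  [AddCommGroup W] [Module k W]

/-- The identity of `V` in the divided power category. -/
noncomputable def id (k : Type u) [Field k] (n : ℕ) (V : Type u) [AddCommGroup V] [Module k V] :
    GammaHom k n V V :=
  ⟨LinearMap.id, fun σ => by rw [LinearMap.comp_id, LinearMap.id_comp]⟩

/-- The composite `g ∘ f` in the divided power category. -/
noncomputable def comp (g : GammaHom k n V W) (f : GammaHom k n U V) :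
    GammaHom k n U W :=
  ⟨g.1 ∘ₗ f.1, fun σ => by
    rw [← LinearMap.comp_assoc, g.2 σ, LinearMap.comp_assoc, f.2 σ, LinearMap.comp_assoc]⟩

end GammaHom

namespace SuperGammaHom

variable {n : ℕ} {U V W : SuperSpace k}

/-- The identity of `V` in the super divided power category. -/
noncomputable def id (n : ℕ) (V : SuperSpace k) : SuperGammaHom n V V :=
  ⟨LinearMap.id, fun σ => by rw [LinearMap.comp_id, LinearMap.id_comp]⟩

/-- The composite `g ∘ f` in the super divided power category. -/
noncomputable def comp (g : SuperGammaHom n V W) (f : SuperGammaHom n U V) :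
    SuperGammaHom n U W :=
  ⟨g.1 ∘ₗ f.1, fun σ => by
    rw [← LinearMap.comp_assoc, g.2 σ, LinearMap.comp_assoc, f.2 σ, LinearMap.comp_assoc]⟩

/-- The `ℤ/2`-grading of the super version of `Γ^n Hom(V, W)`: `f` has parity `a` if it is
homogeneous of parity `a` as a map `V^{⊗n} → W^{⊗n}`. -/
def HasParity (f : SuperGammaHom n V W) (a : ZMod 2) : Prop :=
  IsHomogeneous (tensorGrade n V) (tensorGrade n W) a f.1

end SuperGammaHom

end LinearAlgebra

/-! ### Strict polynomial functors -/

/-- A homogeneous strict polynomial functor of degree `d`: a `k`-linear functor from the `d`-th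
divided power of the category of finite-dimensional vector spaces to finite-dimensional vector
spaces. -/
structure PolyFunctor (k : Type u) [Field k] (d : ℕ) where
  obj : FGModuleCat.{u} k → FGModuleCat.{u} k
  map : ∀ {V W : FGModuleCat.{u} k}, GammaHom k d V W →ₗ[k] (obj V →ₗ[k] obj W)
  map_id : ∀ V : FGModuleCat.{u} k, map (GammaHom.id k d V) = LinearMap.id
  map_comp : ∀ {U V W : FGModuleCat.{u} k} (g : GammaHom k d V W)
    (f : GammaHom k d U V), map (GammaHom.comp g f) = map g ∘ₗ map f

namespace PolyFunctor

variable {k : Type u} [Field k] {d : ℕ}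

/-- A morphism of strict polynomial functors: a natural transformation. -/
@[ext]
structure Hom (F G : PolyFunctor k d) where
  app : ∀ V : FGModuleCat.{u} k, F.obj V →ₗ[k] G.obj V
  naturality : ∀ {V W : FGModuleCat.{u} k} (f : GammaHom k d V W),
    G.map f ∘ₗ app V = app W ∘ₗ F.map f

instance : Category (PolyFunctor k d) where
  Hom := Hom
  id F := ⟨fun _ => LinearMap.id, fun f => by rw [LinearMap.comp_id, LinearMap.id_comp]⟩
  comp α β := ⟨fun V => β.app V ∘ₗ α.app V, fun f => by
    rw [← LinearMap.comp_assoc, β.naturality, LinearMap.comp_assoc, α.naturality,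
      LinearMap.comp_assoc]⟩

/-- The standard projective `Γ^{d,V} = Γ^d Hom(V, -)`. -/
noncomputable def divPow (d : ℕ) (V : FGModuleCat.{u} k) : PolyFunctor k d where
  obj W := FGModuleCat.of k (GammaHom k d V W)
  map {W X} := LinearMap.mk₂ k (fun (g : GammaHom k d W X)
      (f : GammaHom k d V W) => GammaHom.comp g f)
    (fun _ _ _ => Subtype.ext (LinearMap.add_comp _ _ _))
    (fun _ _ _ => Subtype.ext (LinearMap.smul_comp _ _ _))
    (fun _ _ _ => Subtype.ext (LinearMap.comp_add _ _ _))
    (fun _ _ _ => Subtype.ext (LinearMap.comp_smul _ _ _))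
  map_id _ := rfl
  map_comp _ _ := rfl

/-- The contravariant functoriality of `Γ^{d,V}` in `V`: the natural transformation
`Γ^{d,W} → Γ^{d,V}` given by precomposition with `f ∈ Γ^d Hom(V, W)`. -/
noncomputable def divPowMap {V W : FGModuleCat.{u} k} (f : GammaHom k d V W) :
    divPow d W ⟶ divPow d V where
  app X :=
    { toFun := fun g : GammaHom k d W X => GammaHom.comp g f
      map_add' := fun _ _ => Subtype.ext (LinearMap.add_comp _ _ _)
      map_smul' := fun _ _ => Subtype.ext (LinearMap.smul_comp _ _ _) }
  naturality _ := rfl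

end PolyFunctor

/-! ### Strict polynomial superfunctors -/

/-- A homogeneous strict polynomial superfunctor of degree `d`: an even `k`-linear functor from the
`d`-th super divided power of the category of finite-dimensional super vector spaces to
finite-dimensional super vector spaces. -/
structure SuperPolyFunctor (k : Type u) [Field k] (d : ℕ) where
  obj : SuperSpace k → SuperSpace k
  map : ∀ {V W : SuperSpace k}, SuperGammaHom d V W →ₗ[k] (obj V →ₗ[k] obj W)
  map_parity : ∀ {V W : SuperSpace k} (f : SuperGammaHom d V W) (a : ZMod 2), SuperGammaHom.HasParity f a →
    IsHomogeneous (obj V).grade (obj W).grade a (map f)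
  map_id : ∀ V : SuperSpace k, map (SuperGammaHom.id d V) = LinearMap.id
  map_comp : ∀ {U V W : SuperSpace k} (g : SuperGammaHom d V W) (f : SuperGammaHom d U V),
    map (SuperGammaHom.comp g f) = map g ∘ₗ map f

namespace SuperPolyFunctor

variable {k : Type u} [Field k] {d : ℕ}

/-- The space of homogeneous natural transformations `F → G` of parity `a`: families of linear maps
`η_V : F(V) → G(V)` of parity `a` with `G(f) ∘ η_V = (-1)^{ab} η_W ∘ F(f)` for all `f` of
parity `b`. -/
def homGrade (F G : SuperPolyFunctor k d) (a : ZMod 2) :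
    Submodule k (∀ V : SuperSpace k, F.obj V →ₗ[k] G.obj V) where
  carrier := {η | (∀ V, IsHomogeneous (F.obj V).grade (G.obj V).grade a (η V)) ∧
    ∀ (V W : SuperSpace k) (b : ZMod 2) (f : SuperGammaHom d V W), SuperGammaHom.HasParity f b →
      G.map f ∘ₗ η V = koszul k a b • (η W ∘ₗ F.map f)}
  add_mem' {η θ} hη hθ := ⟨fun V c x hx => add_mem (hη.1 V c x hx) (hθ.1 V c x hx),
    fun V W b f hf => by
      rw [Pi.add_apply, Pi.add_apply, LinearMap.comp_add, LinearMap.add_comp, hη.2 V W b f hf,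
        hθ.2 V W b f hf, smul_add]⟩
  zero_mem' := ⟨fun V c x hx => zero_mem _, fun V W b f hf => by
      rw [Pi.zero_apply, Pi.zero_apply, LinearMap.comp_zero, LinearMap.zero_comp, smul_zero]⟩
  smul_mem' c η hη := ⟨fun V e x hx => Submodule.smul_mem _ c (hη.1 V e x hx),
    fun V W b f hf => by
      rw [Pi.smul_apply, Pi.smul_apply, LinearMap.comp_smul, LinearMap.smul_comp,
        hη.2 V W b f hf, smul_comm]⟩

/-- The space `Hom(F, G) = Hom(F, G)₀ ⊕ Hom(F, G)₁` of morphisms of strict polynomial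
superfunctors: sums of an even and an odd natural transformation. -/
def homSpace (F G : SuperPolyFunctor k d) :
    Submodule k (∀ V : SuperSpace k, F.obj V →ₗ[k] G.obj V) :=
  homGrade F G 0 ⊔ homGrade F G 1

theorem comp_mem_homGrade {F G H : SuperPolyFunctor k d} {a b : ZMod 2}
    {η : ∀ V : SuperSpace k, F.obj V →ₗ[k] G.obj V}
    {θ : ∀ V : SuperSpace k, G.obj V →ₗ[k] H.obj V}
    (hη : η ∈ homGrade F G a) (hθ : θ ∈ homGrade G H b) :
    (fun V => θ V ∘ₗ η V) ∈ homGrade F H (a + b) := by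
  refine ⟨fun V c x hx => ?_, fun V W c f hf => ?_⟩
  · have := hθ.1 V _ _ (hη.1 V c x hx)
    rwa [add_assoc] at this
  · have hk : koszul k (a + b) c = koszul k b c * koszul k a c := by
      have h : ((a + b).val * c.val) % 2 = (b.val * c.val + a.val * c.val) % 2 := by
        clear hη hθ hf; revert a b c; decide
      rw [koszul, koszul, koszul, ← pow_add, neg_one_pow_eq_pow_mod_two, h,
        ← neg_one_pow_eq_pow_mod_two]
    rw [← LinearMap.comp_assoc, hθ.2 V W c f hf, LinearMap.smul_comp, LinearMap.comp_assoc,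
      hη.2 V W c f hf, LinearMap.comp_smul, smul_smul, LinearMap.comp_assoc, hk]

theorem comp_mem_homSpace {F G H : SuperPolyFunctor k d}
    {η : ∀ V : SuperSpace k, F.obj V →ₗ[k] G.obj V}
    {θ : ∀ V : SuperSpace k, G.obj V →ₗ[k] H.obj V}
    (hη : η ∈ homSpace F G) (hθ : θ ∈ homSpace G H) :
    (fun V => θ V ∘ₗ η V) ∈ homSpace F H := by
  have le : ∀ a, homGrade F H a ≤ homSpace F H := by
    intro a
    fin_cases a
    · exact le_sup_left
    · exact le_sup_right
  obtain ⟨η₀, h₀, η₁, h₁, rfl⟩ := Submodule.mem_sup.1 hη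
  obtain ⟨θ₀, g₀, θ₁, g₁, rfl⟩ := Submodule.mem_sup.1 hθ
  have : (fun V => (θ₀ + θ₁) V ∘ₗ (η₀ + η₁) V) =
      ((fun V => θ₀ V ∘ₗ η₀ V) + fun V => θ₀ V ∘ₗ η₁ V) +
        ((fun V => θ₁ V ∘ₗ η₀ V) + fun V => θ₁ V ∘ₗ η₁ V) := by
    funext V
    simp only [Pi.add_apply, LinearMap.add_comp, LinearMap.comp_add]
    abel
  rw [this]
  exact add_mem (add_mem (le _ (comp_mem_homGrade h₀ g₀)) (le _ (comp_mem_homGrade h₁ g₀)))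
    (add_mem (le _ (comp_mem_homGrade h₀ g₁)) (le _ (comp_mem_homGrade h₁ g₁)))

theorem id_mem_homSpace (F : SuperPolyFunctor k d) :
    (fun _ => LinearMap.id) ∈ homSpace F F := by
  refine Submodule.mem_sup_left ⟨fun V b x hx => ?_, fun V W b f hf => ?_⟩
  · simpa using hx
  · simp [koszul]

instance : Category (SuperPolyFunctor k d) where
  Hom F G := homSpace F G
  id F := ⟨fun _ => LinearMap.id, id_mem_homSpace F⟩
  comp η θ := ⟨fun V => θ.1 V ∘ₗ η.1 V, comp_mem_homSpace η.2 θ.2⟩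

/-- The component `F(V) → G(V)` of a morphism of strict polynomial superfunctors. -/
def app {F G : SuperPolyFunctor k d} (η : F ⟶ G) (V : SuperSpace k) : F.obj V →ₗ[k] G.obj V :=
  η.1 V

instance : Preadditive (SuperPolyFunctor k d) where
  homGroup F G := inferInstanceAs (AddCommGroup (homSpace F G))
  add_comp _ _ _ _ _ _ := Subtype.ext (funext fun _ => LinearMap.comp_add _ _ _)
  comp_add _ _ _ _ _ _ := Subtype.ext (funext fun _ => LinearMap.add_comp _ _ _)

instance : Linear k (SuperPolyFunctor k d) where
  homModule F G := inferInstanceAs (Module k (homSpace F G))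
  smul_comp _ _ _ _ _ _ := Subtype.ext (funext fun _ => LinearMap.comp_smul _ _ _)
  comp_smul _ _ _ _ _ _ := Subtype.ext (funext fun _ => LinearMap.smul_comp _ _ _)

end SuperPolyFunctor

/-! ### The Frobenius twist -/

section Frobenius

variable {k : Type u} [Field k] (p : ℕ) [Fact p.Prime] [CharP k p] (r : ℕ)

/-- The field `k`, viewed as a `k`-algebra through `x ↦ x ^ (p ^ r)`. -/
def FrobCoeff (k : Type u) (_p _r : ℕ) : Type u := k

instance : Field (FrobCoeff k p r) := inferInstanceAs (Field k)

noncomputable instance : Algebra k (FrobCoeff k p r) :=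
  (show k →+* FrobCoeff k p r from iterateFrobenius k p r).toAlgebra

/-- The Frobenius twist `V^{(r)} = k ⊗_φ V` of a vector space `V`, the base change of `V` along
`φ : k → k`, `x ↦ x ^ (p ^ r)`. -/
def Twist (V : Type u) [AddCommGroup V] [Module k V] : Type u := FrobCoeff k p r ⊗[k] V

variable (V W : Type u) [AddCommGroup V] [Module k V] [AddCommGroup W] [Module k W]

noncomputable instance : AddCommGroup (Twist (k := k) p r V) :=
  inferInstanceAs (AddCommGroup (FrobCoeff k p r ⊗[k] V))

/-- The `k`-module structure of `V^{(r)}`: scalars act on the left factor of `k ⊗_φ V`. -/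
noncomputable instance : Module k (Twist (k := k) p r V) :=
  inferInstanceAs (Module (FrobCoeff k p r) (FrobCoeff k p r ⊗[k] V))

noncomputable instance [Module.Finite k V] : Module.Finite k (Twist (k := k) p r V) :=
  inferInstanceAs (Module.Finite (FrobCoeff k p r) (FrobCoeff k p r ⊗[k] V))

variable {V W}

/-- The vector `v^{(r)} = 1 ⊗ v` of `V^{(r)}`. -/
noncomputable def twistVec (v : V) : Twist (k := k) p r V := (1 : FrobCoeff k p r) ⊗ₜ[k] v

/-- The basis of `V^{(r)}` formed by the twists of the vectors of a basis of `V`. -/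
noncomputable def twistBasis {ι : Type*} (b : Module.Basis ι k V) :
    Module.Basis ι k (Twist (k := k) p r V) :=
  show Module.Basis ι (FrobCoeff k p r) (FrobCoeff k p r ⊗[k] V) from
    Algebra.TensorProduct.basis (FrobCoeff k p r) b

theorem twistBasis_apply {ι : Type*} (b : Module.Basis ι k V) (i : ι) :
    twistBasis p r b i = twistVec p r (b i) :=
  Algebra.TensorProduct.basis_apply b i

theorem twistBasis_repr {ι : Type*} (b : Module.Basis ι k V) (v : V) (i : ι) :
    (twistBasis p r b).repr (twistVec p r v) i = (b.repr v i) ^ p ^ r := by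
  have := DFunLike.congr_fun
    (Algebra.TensorProduct.basis_repr_tmul (A := FrobCoeff k p r) b 1 v) i
  refine this.trans ?_
  rw [one_smul, Finsupp.mapRange_apply]
  rfl

end Frobenius

section FrobGamma

variable {k : Type u} [Field k]

/-- A basis of `V` adapted to the grading: a basis of `V₀` followed by a basis of `V₁`. -/
noncomputable def SuperSpace.basis (V : SuperSpace k) :
    Module.Basis (Fin (Module.finrank k (V.grade 0)) ⊕ Fin (Module.finrank k (V.grade 1))) k V :=
  ((Module.finBasis k (V.grade 0)).prod (Module.finBasis k (V.grade 1))).map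
    ((V.grade 0).prodEquivOfIsCompl (V.grade 1) V.isCompl)

/-- The parity of a vector of the adapted basis. -/
def parity {a b : ℕ} : Fin a ⊕ Fin b → ZMod 2 := Sum.elim (fun _ => 0) (fun _ => 1)

theorem SuperSpace.basis_mem (V : SuperSpace k)
    (x : Fin (Module.finrank k (V.grade 0)) ⊕ Fin (Module.finrank k (V.grade 1))) :
    V.basis x ∈ V.grade (parity x) := by
  rcases x with x | x <;> simp [SuperSpace.basis, parity]

theorem SuperSpace.basis_inl (V : SuperSpace k) (x : Fin (Module.finrank k (V.grade 0))) :
    V.basis (Sum.inl x) = (Module.finBasis k (V.grade 0) x : V) := by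
  simp [SuperSpace.basis]

theorem SuperSpace.basis_repr_odd (V : SuperSpace k) (v : V) (hv : v ∈ V.grade 1)
    (x : Fin (Module.finrank k (V.grade 0))) : V.basis.repr v (Sum.inl x) = 0 := by
  have : ((V.grade 0).prodEquivOfIsCompl (V.grade 1) V.isCompl).symm v = (0, ⟨v, hv⟩) := by
    rw [LinearEquiv.symm_apply_eq]; simp
  simp [SuperSpace.basis, this]

theorem SuperSpace.proj_of_mem (V : SuperSpace k) {a b : ZMod 2} {v : V} (hv : v ∈ V.grade b) :
    V.proj a v = if a = b then v else 0 := by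
  have hz : ∀ c : ZMod 2, c = 0 ∨ c = 1 := by decide
  have h10 : (1 : ZMod 2) ≠ 0 := by decide
  unfold SuperSpace.proj
  rcases hz a with rfl | rfl <;> rcases hz b with rfl | rfl
  · rw [if_pos rfl, if_pos rfl]
    exact Submodule.projection_apply_of_mem_left _ hv
  · rw [if_pos rfl, if_neg h10.symm]
    exact (Submodule.projection_apply_eq_zero_iff _).2 hv
  · rw [if_neg h10, if_neg h10]
    exact (Submodule.projection_apply_eq_zero_iff _).2 hv
  · rw [if_neg h10, if_pos rfl]
    exact Submodule.projection_apply_of_mem_left _ hv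

theorem perm_tprod {n : ℕ} {V : Type u} [AddCommGroup V] [Module k V] (σ : Equiv.Perm (Fin n))
    (v : Fin n → V) :
    perm n V σ (PiTensorProduct.tprod k v) = PiTensorProduct.tprod k (v ∘ σ.symm) :=
  PiTensorProduct.reindex_tprod σ v

theorem superPerm_tprod {n : ℕ} (V : SuperSpace k) (σ : Equiv.Perm (Fin n)) (v : Fin n → V)
    (ε : Fin n → ZMod 2) (hv : ∀ i, v i ∈ V.grade (ε i)) :
    superPerm n V σ (PiTensorProduct.tprod k v) =
      permSign k σ ε • PiTensorProduct.tprod k (v ∘ σ.symm) := by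
  classical
  rw [superPerm, LinearMap.sum_apply, Finset.sum_eq_single ε]
  · rw [LinearMap.smul_apply, LinearMap.comp_apply, PiTensorProduct.map_tprod, perm_tprod]
    congr 2
    funext i
    simp [V.proj_of_mem (hv _)]
  · intro δ _ hδ
    obtain ⟨i, hi⟩ := Function.ne_iff.1 hδ
    rw [LinearMap.smul_apply, LinearMap.comp_apply, PiTensorProduct.map_tprod,
      (PiTensorProduct.tprod k).map_coord_zero i (by simp [V.proj_of_mem (hv i), hi]), map_zero,
      smul_zero]
  · simp

/-- The basis of `V^{⊗n}` formed by the words in the adapted basis of `V`. -/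
noncomputable def SuperSpace.tbasis (V : SuperSpace k) (n : ℕ) :
    Module.Basis (Fin n → Fin (Module.finrank k (V.grade 0)) ⊕ Fin (Module.finrank k (V.grade 1)))
      k (TPow k n V) :=
  Basis.piTensorProduct fun _ => V.basis

theorem SuperSpace.tbasis_apply (V : SuperSpace k) (n : ℕ) (w) :
    V.tbasis n w = PiTensorProduct.tprod k (V.basis ∘ w) :=
  Basis.piTensorProduct_apply _ _

theorem superPerm_tbasis {n : ℕ} (V : SuperSpace k) (σ : Equiv.Perm (Fin n)) (w) :
    superPerm n V σ (V.tbasis n w) =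
      permSign k σ (parity ∘ w) • V.tbasis n (w ∘ σ.symm) := by
  rw [V.tbasis_apply, V.tbasis_apply]
  exact superPerm_tprod V σ _ _ fun i => V.basis_mem (w i)

theorem repr_superPerm {n : ℕ} (V : SuperSpace k) (σ : Equiv.Perm (Fin n)) (x : TPow k n V) (u) :
    (V.tbasis n).repr (superPerm n V σ x) (u ∘ σ.symm) =
      permSign k σ (parity ∘ u) * (V.tbasis n).repr x u := by
  classical
  have key : (Finsupp.lapply (u ∘ σ.symm) ∘ₗ (V.tbasis n).repr.toLinearMap) ∘ₗ superPerm n V σ =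
      permSign k σ (parity ∘ u) • (Finsupp.lapply u ∘ₗ (V.tbasis n).repr.toLinearMap) := by
    refine (V.tbasis n).ext fun w => ?_
    have hw : w ∘ σ.symm = u ∘ σ.symm ↔ w = u :=
      (σ.symm.surjective.injective_comp_right).eq_iff
    simp only [LinearMap.comp_apply, superPerm_tbasis, LinearMap.smul_apply, map_smul,
      LinearEquiv.coe_coe, Module.Basis.repr_self, Finsupp.lapply_apply, Finsupp.single_apply, hw,
      smul_eq_mul]
    split_ifs with h
    · rw [h]
    · simp
  exact LinearMap.congr_fun key x

/-- The matrix entry of `f ∈ Γ^n Hom(V, W)` at two words in the adapted bases. -/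
noncomputable def entry {n : ℕ} {V W : SuperSpace k} (f : SuperGammaHom n V W)
    (u : Fin n → Fin (Module.finrank k (W.grade 0)) ⊕ Fin (Module.finrank k (W.grade 1)))
    (w : Fin n → Fin (Module.finrank k (V.grade 0)) ⊕ Fin (Module.finrank k (V.grade 1))) : k :=
  (W.tbasis n).repr (f.1 (V.tbasis n w)) u

theorem entry_perm {n : ℕ} {V W : SuperSpace k} (f : SuperGammaHom n V W)
    (σ : Equiv.Perm (Fin n)) (u w) :
    permSign k σ (parity ∘ w) * entry f (u ∘ σ.symm) (w ∘ σ.symm) =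
      permSign k σ (parity ∘ u) * entry f u w := by
  have h := LinearMap.congr_fun (f.2 σ) (V.tbasis n w)
  rw [LinearMap.comp_apply, LinearMap.comp_apply, superPerm_tbasis, map_smul] at h
  rw [entry, entry, ← repr_superPerm, h, map_smul]
  rfl

theorem permSign_mul_self {n : ℕ} (σ : Equiv.Perm (Fin n)) (ε : Fin n → ZMod 2) :
    permSign k σ ε * permSign k σ ε = 1 := by
  rw [permSign, ← Finset.prod_mul_distrib]
  refine Finset.prod_eq_one fun x _ => ?_
  rw [koszul, ← pow_add, ← two_mul, pow_mul]
  simp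

theorem permSign_even {n : ℕ} (σ : Equiv.Perm (Fin n)) : permSign k σ (fun _ => 0) = 1 :=
  Finset.prod_eq_one fun x _ => by simp [koszul]

theorem permSign_swap {n : ℕ} (i j : Fin n) (hij : j.val = i.val + 1) (ε : Fin n → ZMod 2)
    (hi : ε i = 1) (hj : ε j = 1) : permSign k (Equiv.swap i j) ε = -1 := by
  classical
  rw [permSign, Finset.prod_eq_single (i, j)]
  · simp only [hi, hj, koszul]
    norm_num [ZMod.val_one]
  · rintro ⟨a, b⟩ hx hne
    exfalso
    obtain ⟨h1, h2⟩ := (Finset.mem_filter.1 hx).2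
    apply hne
    simp only [Equiv.swap_apply_def] at h1 h2
    split_ifs at h2 <;> simp only [Fin.lt_def, Fin.ext_iff, Prod.mk.injEq] at * <;> omega
  · intro h
    exfalso
    apply h
    refine Finset.mem_filter.2 ⟨Finset.mem_univ _, ?_⟩
    have hlt : i < j := by rw [Fin.lt_def]; omega
    rw [Equiv.swap_apply_right, Equiv.swap_apply_left]
    exact ⟨hlt, hlt⟩

theorem entry_id {n : ℕ} (V : SuperSpace k) (u w) :
    entry (SuperGammaHom.id n V) u w = if w = u then 1 else 0 := by
  classical
  rw [entry]
  change (V.tbasis n).repr (V.tbasis n w) u = _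
  rw [Module.Basis.repr_self, Finsupp.single_apply]

theorem entry_comp {n : ℕ} {U V W : SuperSpace k} (g : SuperGammaHom n V W)
    (f : SuperGammaHom n U V) (u w) :
    entry (SuperGammaHom.comp g f) u w = ∑ v, entry g u v * entry f v w := by
  rw [entry]
  change (W.tbasis n).repr (g.1 (f.1 (U.tbasis n w))) u = _
  conv_lhs => rw [← (V.tbasis n).sum_repr (f.1 (U.tbasis n w))]
  rw [map_sum, map_sum, Finsupp.finsetSum_apply]
  refine Finset.sum_congr rfl fun v _ => ?_
  rw [map_smul, map_smul, Finsupp.smul_apply, smul_eq_mul, mul_comm]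
  rfl

/-- The word of length `d * q` in which every letter of the word `J` of even letters is repeated
`q` times. -/
def stretch {d q a b : ℕ} (J : Fin d → Fin a) : Fin (d * q) → Fin a ⊕ Fin b :=
  fun t => Sum.inl (J t.divNat)

theorem permSign_stretch {d q a b : ℕ} (σ : Equiv.Perm (Fin (d * q))) (J : Fin d → Fin a) :
    permSign k σ (parity ∘ (stretch J : Fin (d * q) → Fin a ⊕ Fin b)) = 1 :=
  permSign_even σ

theorem entry_odd {d q : ℕ} (hq : 2 ≤ q) (hk : (2 : k) ≠ 0) {V W : SuperSpace k}
    (f : SuperGammaHom (d * q) V W) (J : Fin d → Fin (Module.finrank k (W.grade 0)))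
    (K : Fin d → Fin (Module.finrank k (V.grade 0)) ⊕ Fin (Module.finrank k (V.grade 1)))
    (i : Fin d) (y) (hi : K i = Sum.inr y) : entry f (stretch J) (K ∘ Fin.divNat) = 0 := by
  have h0 : (finProdFinEquiv (i, (⟨0, by omega⟩ : Fin q))).divNat = i :=
    congrArg Prod.fst (finProdFinEquiv.symm_apply_apply (i, (⟨0, by omega⟩ : Fin q)))
  have h1 : (finProdFinEquiv (i, (⟨1, by omega⟩ : Fin q))).divNat = i :=
    congrArg Prod.fst (finProdFinEquiv.symm_apply_apply (i, (⟨1, by omega⟩ : Fin q)))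
  set s : Fin (d * q) := finProdFinEquiv (i, (⟨0, by omega⟩ : Fin q)) with hs
  set t : Fin (d * q) := finProdFinEquiv (i, (⟨1, by omega⟩ : Fin q)) with ht
  have hdiv : ∀ x, ((Equiv.swap s t).symm x).divNat = x.divNat := by
    intro x
    rw [Equiv.symm_swap, Equiv.swap_apply_def]
    split_ifs with h h'
    · rw [h, h0, h1]
    · rw [h', h0, h1]
    · rfl
  have h := entry_perm f (Equiv.swap s t) (stretch J) (K ∘ Fin.divNat)
  have e1 : (stretch J : Fin (d * q) → _ ⊕ Fin (Module.finrank k (W.grade 1))) ∘ (Equiv.swap s t).symm = stretch J := by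
    funext x
    simp only [stretch, Function.comp_apply, hdiv]
  have e2 : (K ∘ Fin.divNat : Fin (d * q) → _) ∘ (Equiv.swap s t).symm = K ∘ Fin.divNat := by
    funext x
    simp only [Function.comp_apply, hdiv]
  rw [e1, e2, permSign_stretch, permSign_swap s t (by simp [hs, ht, finProdFinEquiv, add_comm])
    _ (by simp [h0, hi, parity]) (by simp [h1, hi, parity])] at h
  have h2 : (2 : k) * entry f (stretch J) (K ∘ Fin.divNat) = 0 := by linear_combination -h
  exact (mul_eq_zero.1 h2).resolve_left hk

theorem entry_comp_stretch {p : ℕ} [Fact p.Prime] [CharP k p] (hp : p ≠ 2) {d r : ℕ} (hr : r ≠ 0)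
    {U V W : SuperSpace k} (g : SuperGammaHom (d * p ^ r) V W) (f : SuperGammaHom (d * p ^ r) U V)
    (J : Fin d → Fin (Module.finrank k (W.grade 0)))
    (I : Fin d → Fin (Module.finrank k (U.grade 0))) :
    entry (SuperGammaHom.comp g f) (stretch J) (stretch I) =
      ∑ K : Fin d → Fin (Module.finrank k (V.grade 0)),
        entry g (stretch J) (stretch K) * entry f (stretch K) (stretch I) := by
  have hp' : p.Prime := Fact.out
  have hk : (2 : k) ≠ 0 := fun h => by
    have : ((2 : ℕ) : k) = 0 := by exact_mod_cast h
    rw [CharP.cast_eq_zero_iff k p] at this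
    exact hp ((Nat.prime_dvd_prime_iff_eq hp' Nat.prime_two).1 this)
  have hq : 2 ≤ p ^ r := hp'.two_le.trans (Nat.le_self_pow hr p)
  rw [entry_comp, sum_words (p := p) d r _ ?_]
  · symm
    refine Fintype.sum_of_injective (fun K : Fin d → Fin (Module.finrank k (V.grade 0)) =>
      fun i => (Sum.inl (K i) : _ ⊕ Fin (Module.finrank k (V.grade 1)))) ?_ _ _ ?_ ?_
    · intro K L h
      funext i
      exact Sum.inl_injective (congrFun h i)
    · intro K hK
      have : ∃ i y, K i = Sum.inr y := by
        by_contra! hno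
        apply hK
        have : ∀ i, ∃ x, K i = Sum.inl x := fun i => by
          rcases h : K i with x | y
          · exact ⟨x, rfl⟩
          · exact absurd h (hno i y)
        choose L hL using this
        exact ⟨L, funext fun i => (hL i).symm⟩
      obtain ⟨i, y, hi⟩ := this
      rw [entry_odd hq hk g J K i y hi, zero_mul]
    · intro K
      rfl
  · intro σ hσ v
    have hσ' : ∀ {a b : ℕ} (L : Fin d → Fin a),
        (stretch L : Fin (d * p ^ r) → Fin a ⊕ Fin b) ∘ σ = stretch L := by
      intro a b L
      funext x
      simp only [stretch, Function.comp_apply, hσ]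
    have h1 := entry_perm g σ.symm (stretch J) v
    have h2 := entry_perm f σ.symm v (stretch I)
    rw [Equiv.symm_symm, hσ', permSign_stretch, one_mul] at h1 h2
    rw [h2, ← h1]
    ring

theorem stretch_matrix_equivariant {d q : ℕ} {V W : SuperSpace k}
    (f : SuperGammaHom (d * q) V W) (σ : Equiv.Perm (Fin d))
    (J I) : entry f (stretch (J ∘ σ.symm)) (stretch (I ∘ σ.symm)) =
      entry f (stretch J) (stretch I) := by
  let τ : Equiv.Perm (Fin (d * q)) :=
    finProdFinEquiv.symm.trans ((Equiv.prodCongr σ (Equiv.refl _)).trans finProdFinEquiv)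
  have hτ : ∀ x, (τ.symm x).divNat = σ.symm x.divNat := fun x =>
    congrArg Prod.fst (finProdFinEquiv.symm_apply_apply (σ.symm x.divNat, x.modNat))
  have h := entry_perm f τ (stretch J) (stretch I)
  have hL : ∀ {a b : ℕ} (L : Fin d → Fin a), (stretch L : Fin (d * q) → Fin a ⊕ Fin b) ∘ τ.symm
      = stretch (L ∘ σ.symm) := by
    intro a b L
    funext x
    simp only [stretch, Function.comp_apply, hτ]
  rwa [hL, hL, permSign_stretch, permSign_stretch, one_mul, one_mul] at h

section Def

variable (p : ℕ) [Fact p.Prime] [CharP k p] (r : ℕ)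

/-- The basis of `(V^{(r)})^{⊗d}` formed by the words in the twist of a basis of `V`. -/
noncomputable def ttwistBasis (d : ℕ) (V : Type u) [AddCommGroup V] [Module k V]
    [Module.Finite k V] :
    Module.Basis (Fin d → Fin (Module.finrank k V)) k (TPow k d (Twist (k := k) p r V)) :=
  Basis.piTensorProduct fun _ => twistBasis p r (Module.finBasis k V)

theorem ttwistBasis_apply (d : ℕ) (V : Type u) [AddCommGroup V] [Module k V]
    [Module.Finite k V] (I : Fin d → Fin (Module.finrank k V)) :
    ttwistBasis p r d V I =
      PiTensorProduct.tprod k fun i => twistBasis p r (Module.finBasis k V) (I i) :=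
  Basis.piTensorProduct_apply _ _

variable {d : ℕ} {V W : SuperSpace k}

/-- The matrix entries of `f ∈ Γ^{d p^r} Hom(V, W)` at the words that repeat each of `d` even basis
vectors `p^r` times. -/
noncomputable def stretchMatrix (d : ℕ) (V W : SuperSpace k) : SuperGammaHom (d * p ^ r) V W →ₗ[k]
    Matrix (Fin d → Fin (Module.finrank k (W.grade 0)))
      (Fin d → Fin (Module.finrank k (V.grade 0))) k where
  toFun f := Matrix.of fun J I => entry f (stretch J) (stretch I)
  map_add' f g := by
    ext J I
    simp [entry]
  map_smul' c f := by
    ext J I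
    simp [entry]

theorem perm_ttwistBasis (V : Type u) [AddCommGroup V] [Module k V] [Module.Finite k V]
    (σ : Equiv.Perm (Fin d)) (I : Fin d → Fin (Module.finrank k V)) :
    perm d _ σ (ttwistBasis p r d V I) = ttwistBasis p r d V (I ∘ σ.symm) := by
  rw [ttwistBasis_apply, perm_tprod, ttwistBasis_apply]
  rfl

theorem stretchMatrix_mem (f : SuperGammaHom (d * p ^ r) V W) :
    Matrix.toLin (ttwistBasis p r d (V.grade 0)) (ttwistBasis p r d (W.grade 0))
      (stretchMatrix p r d V W f) ∈
        GammaHom k d (Twist (k := k) p r (V.grade 0)) (Twist (k := k) p r (W.grade 0)) := by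
  intro σ
  refine (ttwistBasis p r d (V.grade 0)).ext fun I => ?_
  rw [LinearMap.comp_apply, LinearMap.comp_apply, perm_ttwistBasis, Matrix.toLin_self,
    Matrix.toLin_self, map_sum]
  refine Fintype.sum_equiv (Equiv.arrowCongr σ (Equiv.refl _)) _ _ fun J => ?_
  rw [map_smul, perm_ttwistBasis]
  exact congrArg₂ (· • ·) (stretch_matrix_equivariant f σ J I).symm rfl

/-- The map of divided powers `Γ^{d p^r} Hom(V, W) → Γ^d Hom(V₀^{(r)}, W₀^{(r)})` induced by the
Frobenius. In terms of bases `v_i` of `V₀` and `w_j` of `W₀` (completed to homogeneous bases), the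
matrix entry of the image of `f` at `(w_{J 1}^{(r)} ⊗ ⋯ ⊗ w_{J d}^{(r)}, v_{I 1}^{(r)} ⊗ ⋯)` is the
matrix entry of `f` at `(w_{J 1}^{⊗ p^r} ⊗ ⋯ ⊗ w_{J d}^{⊗ p^r}, v_{I 1}^{⊗ p^r} ⊗ ⋯)`. The theorem
`frobGamma_spec` shows that it does not depend on the bases. -/
noncomputable def frobGamma (d : ℕ) (V W : SuperSpace k) :
    SuperGammaHom (d * p ^ r) V W →ₗ[k]
      GammaHom k d (Twist (k := k) p r (V.grade 0)) (Twist (k := k) p r (W.grade 0)) :=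
  LinearMap.codRestrict _
    ((Matrix.toLin (ttwistBasis p r d (V.grade 0)) (ttwistBasis p r d (W.grade 0))).toLinearMap ∘ₗ
      stretchMatrix p r d V W) (stretchMatrix_mem p r)

theorem frobGamma_id (d : ℕ) (V : SuperSpace k) :
    frobGamma p r d V V (SuperGammaHom.id _ V) = GammaHom.id k d _ := by
  classical
  have hp' : p.Prime := Fact.out
  refine Subtype.ext ?_
  change Matrix.toLin _ _ (Matrix.of fun J I => entry _ (stretch J) (stretch I)) = LinearMap.id
  rw [← Matrix.toLin_one (ttwistBasis p r d (V.grade 0))]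
  congr 1
  ext J I
  rw [Matrix.of_apply, entry_id, Matrix.one_apply]
  have : (stretch I : Fin (d * p ^ r) → _ ⊕ Fin (Module.finrank k (V.grade 1))) = stretch J ↔
      J = I := by
    refine ⟨fun h => funext fun i => ?_, fun h => by rw [h]⟩
    have hi : (finProdFinEquiv (i, (⟨0, pow_pos hp'.pos r⟩ : Fin (p ^ r)))).divNat = i :=
      congrArg Prod.fst (finProdFinEquiv.symm_apply_apply
        (i, (⟨0, pow_pos hp'.pos r⟩ : Fin (p ^ r))))
    have := Sum.inl_injective (congrFun h (finProdFinEquiv (i, ⟨0, pow_pos hp'.pos r⟩)))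
    rw [hi] at this
    exact this.symm
  simp only [this]

theorem frobGamma_comp (hp : p ≠ 2) (hr : r ≠ 0) {U : SuperSpace k}
    (g : SuperGammaHom (d * p ^ r) V W) (f : SuperGammaHom (d * p ^ r) U V) :
    frobGamma p r d U W (SuperGammaHom.comp g f) =
      GammaHom.comp (frobGamma p r d V W g) (frobGamma p r d U V f) := by
  refine Subtype.ext ?_
  change Matrix.toLin _ _ _ = Matrix.toLin _ _ _ ∘ₗ Matrix.toLin _ _ _
  rw [← Matrix.toLin_mul]
  congr 1
  ext J I
  rw [Matrix.mul_apply]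
  exact entry_comp_stretch hp hr g f J I

theorem frobGamma_odd (f : SuperGammaHom (d * p ^ r) V W) (hf : SuperGammaHom.HasParity f 1) :
    frobGamma p r d V W f = 0 := by
  have hz : ∀ c : ZMod 2, c ≠ 0 → c = 1 := by decide
  have hvan : ∀ x ∈ tensorGrade (d * p ^ r) W 1, ∀ J, (W.tbasis _).repr x (stretch J) = 0 := by
    intro x hx J
    induction hx using Submodule.span_induction with
    | mem x h =>
      obtain ⟨ε, v, hv, hε, rfl⟩ := h
      obtain ⟨i, hi⟩ : ∃ i, ε i ≠ 0 := by
        by_contra! h0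
        rw [Finset.sum_eq_zero fun i _ => h0 i] at hε
        exact absurd hε (by decide)
      rw [SuperSpace.tbasis, Basis.piTensorProduct_repr_tprod_apply]
      exact Finset.prod_eq_zero (Finset.mem_univ i)
        (W.basis_repr_odd _ (by simpa [hz _ hi] using hv i) _)
    | zero => simp
    | add x y _ _ hx hy => simp [hx, hy]
    | smul c x _ hx => simp [hx]
  refine Subtype.ext ?_
  change Matrix.toLin _ _ (Matrix.of fun J I => entry _ (stretch J) (stretch I)) = 0
  rw [← map_zero (Matrix.toLin (ttwistBasis p r d (V.grade 0)) (ttwistBasis p r d (W.grade 0)))]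
  congr 1
  ext J I
  rw [Matrix.of_apply, entry]
  refine hvan _ ?_ J
  have := hf 0 ((V.tbasis _) (stretch I)) (Submodule.subset_span
    ⟨fun _ => 0, _, fun i => V.basis_mem (stretch I i), by simp, V.tbasis_apply _ _⟩)
  simpa using this

/-- The functional `c ⊗ v ↦ c ξ(v)^{p^r}` on `V^{(r)}`, for a functional `ξ` on `V`. -/
noncomputable def twistDual {V : Type u} [AddCommGroup V] [Module k V] (ξ : Module.Dual k V) :
    Module.Dual k (Twist (k := k) p r V) :=
  show Module.Dual (FrobCoeff k p r) (FrobCoeff k p r ⊗[k] V) from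
    Module.Dual.baseChange (FrobCoeff k p r) ξ

theorem twistDual_twistVec {V : Type u} [AddCommGroup V] [Module k V] (ξ : Module.Dual k V)
    (v : V) : twistDual p r ξ (twistVec p r v) = ξ v ^ p ^ r := by
  refine (Module.Dual.baseChange_apply_tmul (FrobCoeff k p r) ξ 1 v).trans ?_
  exact (Algebra.smul_def _ _).trans (mul_one _)

theorem tprod_twistVec (V : Type u) [AddCommGroup V] [Module k V] [Module.Finite k V]
    (v : Fin d → V) : PiTensorProduct.tprod k (fun i => twistVec p r (v i)) =
      ∑ I, (∏ i, (Module.finBasis k V).repr (v i) (I i) ^ p ^ r) • ttwistBasis p r d V I := by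
  conv_lhs => rw [← (ttwistBasis p r d V).sum_repr (PiTensorProduct.tprod k _)]
  refine Finset.sum_congr rfl fun I _ => ?_
  rw [ttwistBasis, Basis.piTensorProduct_repr_tprod_apply]
  simp only [twistBasis_repr]

theorem SuperSpace.basis_repr_even (V : SuperSpace k) (v : V.grade 0) (x) :
    V.basis.repr (v : V) x =
      Sum.elim (fun y => (Module.finBasis k (V.grade 0)).repr v y) (fun _ => 0) x := by
  have : ((V.grade 0).prodEquivOfIsCompl (V.grade 1) V.isCompl).symm (v : V) = (v, 0) := by
    rw [LinearEquiv.symm_apply_eq]; simp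
  rcases x with x | x <;> simp [SuperSpace.basis, this]

theorem SuperSpace.projectionOnto_basis (V : SuperSpace k) (x) :
    (V.grade 0).projectionOnto (V.grade 1) V.isCompl (V.basis x) =
      Sum.elim (fun y => Module.finBasis k (V.grade 0) y) (fun _ => 0) x := by
  rcases x with x | x
  · rw [V.basis_inl]
    exact Submodule.projectionOnto_apply_left _ _
  · exact (Submodule.projectionOnto_apply_eq_zero_iff _).2 (V.basis_mem (Sum.inr x))

theorem sum_even_words {n a b : ℕ} (f : (Fin n → Fin a ⊕ Fin b) → k)
    (hf : ∀ w i y, w i = Sum.inr y → f w = 0) :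
    ∑ w, f w = ∑ w : Fin n → Fin a, f (fun t => Sum.inl (w t)) := by
  symm
  refine Fintype.sum_of_injective (fun (w : Fin n → Fin a) t => (Sum.inl (w t) : _ ⊕ Fin b))
    ?_ _ _ ?_ fun _ => rfl
  · intro w w' h
    funext t
    exact Sum.inl_injective (congrFun h t)
  · intro w hw
    by_contra hne
    apply hw
    have : ∀ t, ∃ x, w t = Sum.inl x := fun t => by
      rcases h : w t with x | y
      · exact ⟨x, rfl⟩
      · exact absurd (hf w t y h) hne
    choose L hL using this
    exact ⟨L, funext fun t => (hL t).symm⟩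

theorem prod_divNat {q : ℕ} (g : Fin d → k) :
    ∏ t : Fin (d * q), g t.divNat = ∏ i, g i ^ q := by
  rw [← finProdFinEquiv.prod_comp, Fintype.prod_prod_type]
  refine Finset.prod_congr rfl fun i _ => ?_
  have : ∀ j : Fin q, (finProdFinEquiv (i, j)).divNat = i := fun j =>
    congrArg Prod.fst (finProdFinEquiv.symm_apply_apply (i, j))
  simp [this]

/-- Characterization of `frobGamma` without bases: for `v_i ∈ V₀` and functionals `ξ_i` on `W₀`
(extended by zero to `W`), the value of `ξ₁^{(r)} ⊗ ⋯ ⊗ ξ_d^{(r)}` at the image under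
`frobGamma f` of `v₁^{(r)} ⊗ ⋯ ⊗ v_d^{(r)}` is the value of `ξ₁^{⊗ p^r} ⊗ ⋯ ⊗ ξ_d^{⊗ p^r}` at
`f (v₁^{⊗ p^r} ⊗ ⋯ ⊗ v_d^{⊗ p^r})`. -/
theorem frobGamma_spec (f : SuperGammaHom (d * p ^ r) V W) (v : Fin d → V.grade 0)
    (ξ : Fin d → Module.Dual k (W.grade 0)) :
    PiTensorProduct.dualDistrib (PiTensorProduct.tprod k fun i => twistDual p r (ξ i))
      ((frobGamma p r d V W f).1 (PiTensorProduct.tprod k fun i => twistVec p r (v i))) =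
    PiTensorProduct.dualDistrib (PiTensorProduct.tprod k fun t : Fin (d * p ^ r) =>
        ξ t.divNat ∘ₗ (W.grade 0).projectionOnto (W.grade 1) W.isCompl)
      (f.1 (PiTensorProduct.tprod k fun t => (v t.divNat : V))) := by
  let bV := Module.finBasis k (V.grade 0)
  let bW := Module.finBasis k (W.grade 0)
  let F : (Fin (d * p ^ r) → Fin (Module.finrank k (V.grade 0)) ×
      Fin (Module.finrank k (W.grade 0))) → k := fun z =>
    (∏ t, bV.repr (v t.divNat) (z t).1) *
      (entry f (fun t => Sum.inl (z t).2) (fun t => Sum.inl (z t).1) *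
        ∏ t, ξ t.divNat (bW (z t).2))
  have hF : ∀ σ : Equiv.Perm (Fin (d * p ^ r)), (∀ t, (σ t).divNat = t.divNat) →
      ∀ z, F (z ∘ σ) = F z := by
    intro σ hσ z
    have h := entry_perm f σ.symm (fun t => Sum.inl (z t).2) (fun t => Sum.inl (z t).1)
    have e : ∀ {a b : ℕ} (L : Fin (d * p ^ r) → Fin a),
        permSign k σ.symm (parity ∘ fun t => (Sum.inl (L t) : _ ⊕ Fin b)) = 1 :=
      fun L => permSign_even _
    rw [e, e, one_mul, one_mul, Equiv.symm_symm] at h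
    refine congrArg₂ (· * ·) ?_ (congrArg₂ (· * ·) h ?_)
    · exact Fintype.prod_equiv σ _ _ fun t => by simp [hσ]
    · exact Fintype.prod_equiv σ _ _ fun t => by simp [hσ]
  have hL : PiTensorProduct.dualDistrib (PiTensorProduct.tprod k fun i => twistDual p r (ξ i))
      ((frobGamma p r d V W f).1 (PiTensorProduct.tprod k fun i => twistVec p r (v i))) =
      ∑ z : Fin d → Fin (Module.finrank k (V.grade 0)) × Fin (Module.finrank k (W.grade 0)),
        F (z ∘ Fin.divNat) := by
    rw [← Equiv.sum_comp (Equiv.arrowProdEquivProdArrow (Fin d) (fun _ => _) (fun _ => _)).symm,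
      Fintype.sum_prod_type, tprod_twistVec, map_sum, map_sum]
    refine Finset.sum_congr rfl fun I _ => ?_
    rw [map_smul, map_smul]
    change _ • PiTensorProduct.dualDistrib _ (Matrix.toLin _ _ _ (ttwistBasis p r d _ I)) = _
    rw [Matrix.toLin_self, map_sum, Finset.smul_sum]
    refine Finset.sum_congr rfl fun J _ => ?_
    rw [map_smul, ttwistBasis_apply, PiTensorProduct.dualDistrib_apply]
    simp only [twistBasis_apply, twistDual_twistVec, smul_eq_mul]
    rw [← prod_divNat, ← prod_divNat]
    rfl
  have hR : PiTensorProduct.dualDistrib (PiTensorProduct.tprod k fun t : Fin (d * p ^ r) =>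
        ξ t.divNat ∘ₗ (W.grade 0).projectionOnto (W.grade 1) W.isCompl)
      (f.1 (PiTensorProduct.tprod k fun t => (v t.divNat : V))) = ∑ z, F z := by
    rw [← Equiv.sum_comp (Equiv.arrowProdEquivProdArrow (Fin (d * p ^ r)) (fun _ => _)
      (fun _ => _)).symm, Fintype.sum_prod_type]
    rw [← (V.tbasis _).sum_repr (PiTensorProduct.tprod k fun t => (v t.divNat : V)), map_sum,
      map_sum]
    have hc : ∀ w, (V.tbasis _).repr (PiTensorProduct.tprod k fun t => (v t.divNat : V)) w =
        ∏ t : Fin (d * p ^ r), V.basis.repr (v t.divNat : V) (w t) := fun w => by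
      rw [SuperSpace.tbasis, Basis.piTensorProduct_repr_tprod_apply]
    rw [sum_even_words]
    · refine Finset.sum_congr rfl fun w _ => ?_
      rw [map_smul, map_smul, hc, ← (W.tbasis _).sum_repr (f.1 _), map_sum, sum_even_words,
        Finset.smul_sum]
      · refine Finset.sum_congr rfl fun u _ => ?_
        rw [map_smul, W.tbasis_apply, PiTensorProduct.dualDistrib_apply]
        simp only [SuperSpace.basis_repr_even, LinearMap.comp_apply, Function.comp_apply,
          SuperSpace.projectionOnto_basis, Sum.elim_inl, smul_eq_mul]
        rfl
      · intro u i y hi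
        rw [map_smul, W.tbasis_apply, PiTensorProduct.dualDistrib_apply,
          Finset.prod_eq_zero (Finset.mem_univ i), smul_zero]
        simp [SuperSpace.projectionOnto_basis, hi]
    · intro w i y hi
      rw [hc, Finset.prod_eq_zero (Finset.mem_univ i), zero_smul, map_zero, map_zero]
      simp [SuperSpace.basis_repr_even, hi]
  rw [hL, hR, sum_words d r F hF]

end Def

end FrobGamma

/-! ### Precomposition with the even Frobenius twist -/

section Precomposition

variable {k : Type u} [Field k]

/-- A vector space, viewed as a purely even super vector space. -/
abbrev SuperSpace.ofEven (M : FGModuleCat.{u} k) : SuperSpace k where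
  carrier := M
  grade a := if a = 0 then ⊤ else ⊥
  isCompl := by simpa using isCompl_top_bot

theorem ofEven_isHomogeneous {M N : FGModuleCat.{u} k} (f : M →ₗ[k] N) :
    IsHomogeneous (SuperSpace.ofEven M).grade (SuperSpace.ofEven N).grade 0 f := by
  have hz : ∀ c : ZMod 2, c = 0 ∨ c = 1 := by decide
  intro b x hx
  rcases hz b with rfl | rfl
  · exact Submodule.mem_top (R := k) (M := N)
  · have h0 : x = 0 := hx
    rw [h0, map_zero]
    exact Submodule.zero_mem _

variable (p : ℕ) [Fact p.Prime] [CharP k p] (r : ℕ)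

/-- The vector space `V₀^{(r)}` of a super vector space `V`. -/
noncomputable abbrev evenTwist (V : SuperSpace k) : FGModuleCat.{u} k :=
  FGModuleCat.of k (Twist (k := k) p r (V.grade 0))

variable {d : ℕ}

/-- The superfunctor `F₀^{(r)} = F ∘ I₀^{(r)}`, `V ↦ F(V₀^{(r)})`, with purely even values. -/
noncomputable def frobTwist (hp : p ≠ 2) (hr : r ≠ 0) (F : PolyFunctor k d) :
    SuperPolyFunctor k (d * p ^ r) where
  obj V := SuperSpace.ofEven (F.obj (evenTwist p r V))
  map {V W} := F.map (V := evenTwist p r V) (W := evenTwist p r W) ∘ₗ frobGamma p r d V W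
  map_parity {V W} f a hf b x hx := by
    have hz : ∀ c : ZMod 2, c = 0 ∨ c = 1 := by decide
    rcases hz a with rfl | rfl
    · exact ofEven_isHomogeneous _ b x hx
    · change F.map (V := evenTwist p r V) (W := evenTwist p r W) (frobGamma p r d V W f) x ∈ _
      rw [frobGamma_odd p r f hf, show F.map (V := evenTwist p r V) (W := evenTwist p r W) 0 = 0 from
        map_zero _]
      exact Submodule.zero_mem _
  map_id V := (congrArg (F.map (V := evenTwist p r V) (W := evenTwist p r V))
    (frobGamma_id p r d V)).trans (F.map_id (evenTwist p r V))
  map_comp {U V W} g f := (congrArg (F.map (V := evenTwist p r U) (W := evenTwist p r W))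
    (frobGamma_comp p r hp hr g f)).trans
      (F.map_comp (U := evenTwist p r U) (V := evenTwist p r V) (W := evenTwist p r W) _ _)

/-- The precomposition functor `- ∘ I₀^{(r)}` from strict polynomial functors of degree `d` to
strict polynomial superfunctors of degree `d p^r`. -/
noncomputable def frobPrecomp (k : Type u) [Field k] (p : ℕ) [Fact p.Prime] [CharP k p] (d r : ℕ)
    (hp : p ≠ 2) (hr : r ≠ 0) : PolyFunctor k d ⥤ SuperPolyFunctor k (d * p ^ r) where
  obj F := frobTwist p r hp hr F
  map {F G} α := ⟨fun V => α.app (evenTwist p r V), Submodule.mem_sup_left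
    ⟨fun V => ofEven_isHomogeneous (α.app (evenTwist p r V)), fun V W b f _ => by
      have hk : koszul k 0 b = 1 := by simp [koszul]
      rw [hk, one_smul]
      exact α.naturality (V := evenTwist p r V) (W := evenTwist p r W) (frobGamma p r d V W f)⟩⟩
  map_id _ := rfl
  map_comp _ _ := rfl

end Precomposition

end StrictPoly

/-! Exactness is immediate, since the component of a twisted transformation at `V` is its component
at the even twist of `V`. By the Yoneda lemma a right adjoint `ρ` must satisfy `ρ(G)(V) =
Hom(Γ^{d,V}, ρ(G)) = Hom((Γ^{d,V})₀^{(r)}, G)`, so this formula is taken as the definition. Two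
points then need proof: these Hom spaces are finite-dimensional, so that `ρ(G)` is a strict
polynomial functor at all, and the resulting correspondence is an adjunction.

Signs play no role. The functor `F₀^{(r)}` has purely even values, so it kills odd morphisms, and a
map out of it is just a family commuting with homogeneous morphisms
(`SuperPolyFunctor.mem_homSpace_iff`).

Finiteness follows once evaluation at the purely even space `k^d` is injective on `Hom(F₀^{(r)}, G)`
(`frobTwist_hom_eq_zero`). A word of length `d` in the even basis vectors of `W` involves at most
`d` letters, so it is unchanged by a suitable composite `W → k^d → W`. Grouping words by their set
of letters, and putting in front the diagonal projection onto each group, gives a sum of morphisms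
through `k^d` that fixes every stretched word (`sum_letter_stretch`). The map `frobGamma` sees only
stretched words, so this sum acts on `F₀^{(r)}(W)` as the identity (`frobGamma_eq_id`). Naturality
then expresses a transformation at `W` through its value at `k^d`.

For the adjunction, `α : F₀^{(r)} → G` corresponds to the map sending `x ∈ F(V)` to the twist of its
Yoneda transformation followed by `α`. Conversely, `β : F → ρ(G)` corresponds to evaluating `β x` at
the identity of `V₀^{(r)}`. That these are mutually inverse, and that the second is natural, rests
on `eval_hom_frobAdjoint`. -/

namespace StrictPoly

/-! ### Parity projections and homogeneous maps -/

section Homogeneous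

variable {k : Type u} [Field k]

theorem zmod_two_eq_zero_or_one (c : ZMod 2) : c = 0 ∨ c = 1 := by
  revert c; decide

theorem SuperSpace.proj_mem (V : SuperSpace k) (a : ZMod 2) (v : V) : V.proj a v ∈ V.grade a := by
  unfold SuperSpace.proj
  rcases zmod_two_eq_zero_or_one a with rfl | rfl
  · rw [if_pos rfl]; exact Submodule.projection_apply_mem _ _
  · rw [if_neg (by decide)]; exact Submodule.projection_apply_mem _ _

theorem SuperSpace.proj_add_proj (V : SuperSpace k) : V.proj 0 + V.proj 1 = LinearMap.id := by
  refine LinearMap.ext fun v => ?_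
  obtain ⟨x, hx, y, hy, rfl⟩ := Submodule.mem_sup.1
    (V.isCompl.sup_eq_top.symm ▸ Submodule.mem_top : v ∈ V.grade 0 ⊔ V.grade 1)
  simp [V.proj_of_mem hx, V.proj_of_mem hy]

theorem SuperSpace.eq_zero_of_mem (V : SuperSpace k) {v : V} (h₀ : v ∈ V.grade 0)
    (h₁ : v ∈ V.grade 1) : v = 0 :=
  Submodule.disjoint_def.1 V.isCompl.disjoint v h₀ h₁

theorem SuperSpace.ext_homogeneous {V : SuperSpace k} {M : Type*} [AddCommGroup M] [Module k M]
    {f g : V →ₗ[k] M} (h : ∀ a, ∀ v ∈ V.grade a, f v = g v) : f = g := by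
  refine LinearMap.ext fun v => ?_
  have hv : V.proj 0 v + V.proj 1 v = v := LinearMap.congr_fun V.proj_add_proj v
  rw [← hv, map_add, map_add, h _ _ (V.proj_mem 0 v), h _ _ (V.proj_mem 1 v)]

/-- A map of parity `b` shifts the grading by `b`. This is what makes the parity components of a
natural family natural again. -/
theorem IsHomogeneous.comp_proj {V W : SuperSpace k} {b : ZMod 2} {f : V →ₗ[k] W}
    (hf : IsHomogeneous V.grade W.grade b f) (a : ZMod 2) :
    f ∘ₗ V.proj a = W.proj (a + b) ∘ₗ f := by
  refine SuperSpace.ext_homogeneous fun c v hv => ?_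
  rw [LinearMap.comp_apply, LinearMap.comp_apply, V.proj_of_mem hv, W.proj_of_mem (hf c v hv)]
  simp only [add_left_inj]
  split_ifs <;> simp

end Homogeneous

/-! ### Morphisms out of a superfunctor with purely even values -/

namespace SuperPolyFunctor

variable {k : Type u} [Field k] {d : ℕ} {P G : SuperPolyFunctor k d}

/-- An odd morphism sends even vectors to odd ones, and here every vector is even, so the image lies
in both homogeneous components. -/
theorem map_eq_zero_of_odd (hP : ∀ V, (P.obj V).grade 0 = ⊤) {V W : SuperSpace k}
    {f : SuperGammaHom d V W} (hf : SuperGammaHom.HasParity f 1) : P.map f = 0 :=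
  LinearMap.ext fun x => (P.obj W).eq_zero_of_mem (by simp [hP])
    (by simpa using P.map_parity f 1 hf 0 x (by simp [hP]))

/-- If `P` has purely even values, then no signs occur in the naturality of maps `P → G`. -/
theorem mem_homSpace_iff (hP : ∀ V, (P.obj V).grade 0 = ⊤)
    {η : ∀ V : SuperSpace k, P.obj V →ₗ[k] G.obj V} :
    η ∈ homSpace P G ↔ ∀ (V W : SuperSpace k) (b : ZMod 2) (f : SuperGammaHom d V W),
      SuperGammaHom.HasParity f b → G.map f ∘ₗ η V = η W ∘ₗ P.map f := by
  constructor
  · intro h V W b f hf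
    have key : ∀ a, ∀ θ ∈ homGrade P G a, G.map f ∘ₗ θ V = θ W ∘ₗ P.map f := by
      intro a θ hθ
      rw [hθ.2 V W b f hf]
      -- For even `f` the Koszul sign is `1`; for odd `f` the term carrying it is zero.
      rcases zmod_two_eq_zero_or_one b with rfl | rfl
      · simp [koszul]
      · rw [map_eq_zero_of_odd hP hf]; simp
    obtain ⟨η₀, h₀, η₁, h₁, rfl⟩ := Submodule.mem_sup.1 h
    rw [Pi.add_apply, Pi.add_apply, LinearMap.comp_add, LinearMap.add_comp, key _ _ h₀,
      key _ _ h₁]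
  · intro h
    -- The homogeneous components of the family are obtained by projecting its values in `G`; all of
    -- the source is even, so the parity of the target is the parity of the map.
    have key : ∀ a, (fun V => (G.obj V).proj a ∘ₗ η V) ∈ homGrade P G a := by
      refine fun a => ⟨fun V b x hx => ?_, fun V W b f hf => ?_⟩
      · rcases zmod_two_eq_zero_or_one b with rfl | rfl
        · rw [zero_add]; exact (G.obj V).proj_mem a _
        · rw [(P.obj V).eq_zero_of_mem (by simp [hP]) hx, map_zero]
          exact zero_mem _
      · rw [← LinearMap.comp_assoc, (G.map_parity f b hf).comp_proj, LinearMap.comp_assoc,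
          h V W b f hf]
        rcases zmod_two_eq_zero_or_one b with rfl | rfl
        · simp [koszul, LinearMap.comp_assoc]
        -- For odd `f` both sides vanish, so neither the sign nor the shifted index of the
        -- projection matters.
        · rw [map_eq_zero_of_odd hP hf]; simp
    refine Submodule.mem_sup.2 ⟨_, key 0, _, key 1, funext fun V => ?_⟩
    rw [Pi.add_apply, ← LinearMap.add_comp, SuperSpace.proj_add_proj, LinearMap.id_comp]

end SuperPolyFunctor

/-! ### Two kinds of morphisms in the super divided power category -/

section TensorPower

variable {k : Type u} [Field k] {n : ℕ} {V W : SuperSpace k}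

/-- The tensor power `φ^{⊗n}` of an even map. -/
noncomputable def SuperGammaHom.tensorPower (n : ℕ) (φ : V →ₗ[k] W)
    (hφ : IsHomogeneous V.grade W.grade 0 φ) : SuperGammaHom n V W :=
  ⟨PiTensorProduct.map fun _ => φ, fun σ => by
    refine (V.tbasis n).ext fun w => ?_
    -- An even map preserves the parity of each letter, so the permutation acquires the same sign
    -- before and after it.
    rw [LinearMap.comp_apply, LinearMap.comp_apply, superPerm_tbasis, V.tbasis_apply,
      V.tbasis_apply, PiTensorProduct.map_tprod, map_smul, PiTensorProduct.map_tprod,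
      superPerm_tprod W σ _ (parity ∘ w) fun i => ?_]
    · rfl
    · simpa using hφ _ _ (V.basis_mem (w i))⟩

theorem SuperGammaHom.tensorPower_hasParity (φ : V →ₗ[k] W)
    (hφ : IsHomogeneous V.grade W.grade 0 φ) :
    SuperGammaHom.HasParity (SuperGammaHom.tensorPower n φ hφ) 0 := by
  intro b x hx
  rw [add_zero]
  induction hx using Submodule.span_induction with
  | mem x h =>
    obtain ⟨ε, v, hv, hε, rfl⟩ := h
    refine Submodule.subset_span ⟨ε, fun i => φ (v i), fun i => ?_, hε,
      PiTensorProduct.map_tprod _ _⟩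
    simpa using hφ _ _ (hv i)
  | zero => rw [map_zero]; exact zero_mem _
  | add x y _ _ hx hy => rw [map_add]; exact add_mem hx hy
  | smul c x _ hx => rw [map_smul]; exact Submodule.smul_mem _ _ hx

/-- The endomorphism of `V` in the super divided power category which is diagonal on the words
in the adapted basis, with a symmetric function of the letters as eigenvalues. -/
noncomputable def SuperGammaHom.diagonal (V : SuperSpace k)
    (χ : (Fin n → Fin (Module.finrank k (V.grade 0)) ⊕ Fin (Module.finrank k (V.grade 1))) → k)
    (hχ : ∀ (σ : Equiv.Perm (Fin n)) w, χ (w ∘ σ) = χ w) : SuperGammaHom n V V :=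
  ⟨(V.tbasis n).constr k fun w => χ w • V.tbasis n w, fun σ => by
    refine (V.tbasis n).ext fun w => ?_
    rw [LinearMap.comp_apply, LinearMap.comp_apply, Module.Basis.constr_basis, map_smul,
      superPerm_tbasis, map_smul, Module.Basis.constr_basis, hχ, smul_comm]⟩

theorem SuperGammaHom.diagonal_tbasis (V : SuperSpace k) (χ)
    (hχ : ∀ (σ : Equiv.Perm (Fin n)) w, χ (w ∘ σ) = χ w) (w) :
    (SuperGammaHom.diagonal V χ hχ).1 (V.tbasis n w) = χ w • V.tbasis n w :=
  Module.Basis.constr_basis _ _ _ _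

end TensorPower

/-! ### Factoring the identity through `k^d` -/

section Generation

variable {k : Type u} [Field k] (p : ℕ) [Fact p.Prime] [CharP k p] (r : ℕ) {d : ℕ}

/-- The columns at stretched words are all that enters the matrix of `frobGamma`. So `f` may differ
from the identity on all other words, which leaves room to choose an `f` that factors through `k^d`.
-/
theorem frobGamma_eq_id {V : SuperSpace k} (f : SuperGammaHom (d * p ^ r) V V)
    (hf : ∀ J, f.1 (V.tbasis _ (stretch J)) = V.tbasis _ (stretch J)) :
    frobGamma p r d V V f = GammaHom.id k d _ := by
  rw [← frobGamma_id p r d V]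
  refine Subtype.ext ?_
  change Matrix.toLin _ _ (Matrix.of fun J I => entry _ (stretch J) (stretch I)) =
    Matrix.toLin _ _ (Matrix.of fun J I => entry _ (stretch J) (stretch I))
  congr 1
  ext J I
  rw [Matrix.of_apply, Matrix.of_apply, entry, hf]
  rfl

/-- The purely even super space `k^d`. -/
abbrev evenStd (k : Type u) [Field k] (d : ℕ) : SuperSpace k :=
  SuperSpace.ofEven (FGModuleCat.of k (Fin d → k))

variable {V : SuperSpace k}

/-- The even map `k^d → V` taking the `i`-th standard vector to the `K i`-th even basis vector. -/
noncomputable def letterIncl (K : Fin d → Fin (Module.finrank k (V.grade 0))) :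
    evenStd k d →ₗ[k] V :=
  (Pi.basisFun k (Fin d)).constr k fun i => V.basis (Sum.inl (K i))

theorem letterIncl_isHomogeneous (K : Fin d → Fin (Module.finrank k (V.grade 0))) :
    IsHomogeneous (evenStd k d).grade V.grade 0 (letterIncl K) := by
  intro b x hx
  rcases zmod_two_eq_zero_or_one b with rfl | rfl
  · rw [letterIncl, Module.Basis.constr_apply_fintype]
    exact Submodule.sum_mem _ fun i _ =>
      Submodule.smul_mem _ _ (by simpa [parity] using V.basis_mem (Sum.inl (K i)))
  · have h0 : x = 0 := hx
    rw [h0, map_zero]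
    exact zero_mem _

open Classical in
/-- An even map `V → k^d` which is a section of `letterIncl K` on the letters of `K`. -/
noncomputable def letterProj (K : Fin d → Fin (Module.finrank k (V.grade 0))) :
    V →ₗ[k] evenStd k d :=
  V.basis.constr k (Sum.elim
    -- A letter may occur in `K` several times; any one of its positions will do, since `letterIncl
    -- K` sends each of them back to that letter. Even letters outside `K` and odd letters go to
    -- `0`.
    (fun x => if h : ∃ i, K i = x then Pi.basisFun k (Fin d) h.choose else 0) fun _ => 0)

theorem letterProj_isHomogeneous (K : Fin d → Fin (Module.finrank k (V.grade 0))) :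
    IsHomogeneous V.grade (evenStd k d).grade 0 (letterProj K) := by
  intro b x hx
  rcases zmod_two_eq_zero_or_one b with rfl | rfl
  · exact Submodule.mem_top (R := k) (M := Fin d → k)
  · have h0 : letterProj K x = 0 := by
      rw [letterProj, Module.Basis.constr_apply_fintype, Fintype.sum_sum_type]
      simp [V.basis_repr_odd x hx]
    rw [h0]
    exact zero_mem _

theorem letterIncl_letterProj (K : Fin d → Fin (Module.finrank k (V.grade 0))) (i : Fin d) :
    letterIncl K (letterProj K (V.basis (Sum.inl (K i)))) = V.basis (Sum.inl (K i)) := by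
  have h : ∃ j, K j = K i := ⟨i, rfl⟩
  rw [letterProj, Module.Basis.constr_basis, Sum.elim_inl, dif_pos h, letterIncl,
    Module.Basis.constr_basis, h.choose_spec]

open Classical in
/-- The projection onto the span of the words whose set of letters is that of `K`. -/
noncomputable def letterDiagonal (n : ℕ) (K : Fin d → Fin (Module.finrank k (V.grade 0))) :
    SuperGammaHom n V V :=
  SuperGammaHom.diagonal V (fun w => if Set.range w = Set.range (Sum.inl ∘ K) then 1 else 0)
    -- The set of letters of a word does not change when the word is permuted, so its indicator is a
    -- symmetric eigenvalue.
    fun σ w => by rw [σ.surjective.range_comp]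

/-- In degree `d * q`, the word `stretch J` of `V` is fixed by this sum of composites through
`k^d`. -/
theorem sum_letter_stretch {q : ℕ} (hq : q ≠ 0) (V : SuperSpace k)
    [Fintype (Quotient (Setoid.ker
      (Set.range : (Fin d → Fin (Module.finrank k (V.grade 0))) → Set _)))]
    (J : Fin d → Fin (Module.finrank k (V.grade 0))) :
    (∑ c : Quotient (Setoid.ker
      (Set.range : (Fin d → Fin (Module.finrank k (V.grade 0))) → Set _)),
      SuperGammaHom.comp (SuperGammaHom.tensorPower (d * q) _ (letterIncl_isHomogeneous c.out))
        (SuperGammaHom.comp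
          (SuperGammaHom.tensorPower (d * q) _ (letterProj_isHomogeneous c.out))
          (letterDiagonal (d * q) c.out))).1 (V.tbasis _ (stretch J)) =
      V.tbasis (d * q) (stretch J) := by
  classical
  -- Stretching repeats every letter `q` times with `q ≠ 0`, hence keeps the set of letters.
  have hr : ∀ K : Fin d → Fin (Module.finrank k (V.grade 0)),
      Set.range (stretch J : Fin (d * q) → _ ⊕ Fin (Module.finrank k (V.grade 1))) =
        Set.range (Sum.inl ∘ K) ↔ Set.range J = Set.range K := by
    intro K
    have hs : Function.Surjective (Fin.divNat : Fin (d * q) → Fin d) := fun i =>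
      ⟨finProdFinEquiv (i, ⟨0, Nat.pos_of_ne_zero hq⟩), congrArg Prod.fst
        (finProdFinEquiv.symm_apply_apply (i, (⟨0, Nat.pos_of_ne_zero hq⟩ : Fin q)))⟩
    have : (stretch J : Fin (d * q) → _ ⊕ Fin (Module.finrank k (V.grade 1))) =
      (Sum.inl ∘ J) ∘ Fin.divNat := rfl
    rw [this, hs.range_comp, Set.range_comp, Set.range_comp,
      (Set.image_injective.2 Sum.inl_injective).eq_iff]
  -- The classes are the possible sets of letters. The diagonal projections kill the word for every
  -- class except that of `J`.
  rw [Submodule.coe_sum, LinearMap.sum_apply, Finset.sum_eq_single (Quotient.mk _ J)]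
  · have hK : Set.range (Quotient.mk (Setoid.ker Set.range) J).out = Set.range J :=
      Quotient.mk_out (s := Setoid.ker Set.range) J
    -- The representative may differ from `J`, but it has the same letters, and this suffices for
    -- the composite through `k^d` to fix each letter of `J`.
    generalize (Quotient.mk (Setoid.ker Set.range) J).out = K at hK
    change PiTensorProduct.map _ (PiTensorProduct.map _ ((letterDiagonal _ K).1 _)) = _
    rw [letterDiagonal, SuperGammaHom.diagonal_tbasis, if_pos ((hr K).2 hK.symm), one_smul,
      V.tbasis_apply, PiTensorProduct.map_tprod, PiTensorProduct.map_tprod]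
    congr 1
    funext t
    obtain ⟨i, hi⟩ : J t.divNat ∈ Set.range K := hK ▸ ⟨_, rfl⟩
    change letterIncl K (letterProj K (V.basis (Sum.inl (J t.divNat)))) =
      V.basis (Sum.inl (J t.divNat))
    rw [← hi, letterIncl_letterProj]
  · intro c _ hc
    change PiTensorProduct.map _ (PiTensorProduct.map _ ((letterDiagonal _ c.out).1 _)) = _
    rw [letterDiagonal, SuperGammaHom.diagonal_tbasis, if_neg, zero_smul, map_zero, map_zero]
    intro h
    apply hc
    rw [← Quotient.out_eq c]
    exact Quotient.sound (s := Setoid.ker Set.range) ((hr _).1 h).symm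
  · simp

end Generation

/-! ### Finite-dimensionality of the Hom spaces -/

section RightAdjoint

variable {k : Type u} [Field k] (p : ℕ) [Fact p.Prime] [CharP k p] (r : ℕ) {d : ℕ}
  (hp : p ≠ 2) (hr : r ≠ 0)

theorem frobTwist_grade (F : PolyFunctor k d) (V : SuperSpace k) :
    ((frobTwist p r hp hr F).obj V).grade 0 = ⊤ :=
  (if_pos rfl : (if (0 : ZMod 2) = 0 then (⊤ : Submodule k (F.obj (evenTwist p r V))) else ⊥) = ⊤)

-- The sign-free form of naturality, at an element: since `F₀^{(r)}` is purely even, it holds for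
-- arbitrary morphisms `η`, homogeneous or not.
variable {p r hp hr} in
theorem frobTwist_naturality {F : PolyFunctor k d} {G : SuperPolyFunctor k (d * p ^ r)}
    (η : (frobPrecomp k p d r hp hr).obj F ⟶ G) {V W : SuperSpace k} {b : ZMod 2}
    {f : SuperGammaHom (d * p ^ r) V W} (hf : SuperGammaHom.HasParity f b)
    (x : F.obj (evenTwist p r V)) :
    G.map f (η.1 V x) =
      η.1 W (F.map (V := evenTwist p r V) (W := evenTwist p r W) (frobGamma p r d V W f) x) :=
  LinearMap.congr_fun
    ((SuperPolyFunctor.mem_homSpace_iff (frobTwist_grade p r hp hr F)).1 η.2 V W b f hf) x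

variable {p r hp hr} in
/-- A morphism out of `F₀^{(r)}` is determined by its value at `k^d`. -/
theorem frobTwist_hom_eq_zero {F : PolyFunctor k d} {G : SuperPolyFunctor k (d * p ^ r)}
    (η : frobTwist p r hp hr F ⟶ G) (h : η.1 (evenStd k d) = 0) : η = 0 := by
  classical
  refine Subtype.ext (funext fun W => LinearMap.ext fun x => ?_)
  change η.1 W x = 0
  have hq : p ^ r ≠ 0 := pow_ne_zero _ (Fact.out : p.Prime).ne_zero
  let _ : Fintype (Quotient (Setoid.ker
      (Set.range : (Fin d → Fin (Module.finrank k (W.grade 0))) → Set _))) := Fintype.ofFinite _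
  -- The sum fixes all stretched words, so its image under `frobGamma` is the identity and `x` is a
  -- sum of elements coming from `k^d`.
  have hx : (frobTwist p r hp hr F).map
      (∑ c : Quotient (Setoid.ker
        (Set.range : (Fin d → Fin (Module.finrank k (W.grade 0))) → Set _)),
        SuperGammaHom.comp
          (SuperGammaHom.tensorPower (d * p ^ r) _ (letterIncl_isHomogeneous c.out))
          (SuperGammaHom.comp
            (SuperGammaHom.tensorPower (d * p ^ r) _ (letterProj_isHomogeneous c.out))
            (letterDiagonal (d * p ^ r) c.out))) x = x := by
    refine (congrArg (fun f => F.map (V := evenTwist p r W) (W := evenTwist p r W) f x)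
      (frobGamma_eq_id p r _ (sum_letter_stretch hq W))).trans ?_
    exact LinearMap.congr_fun (F.map_id (evenTwist p r W)) x
  rw [← hx, map_sum, LinearMap.sum_apply, map_sum]
  refine Finset.sum_eq_zero fun c _ => ?_
  rw [SuperPolyFunctor.map_comp, LinearMap.comp_apply]
  -- Naturality is needed only for the last factor `k^d → W`, which is even; `η` is then applied at
  -- `k^d`, where it is zero.
  refine (frobTwist_naturality (hp := hp) (hr := hr) η (SuperGammaHom.tensorPower_hasParity _
    (letterIncl_isHomogeneous c.out)) _).symm.trans ?_
  exact (congrArg (G.map _) (LinearMap.congr_fun h _)).trans (map_zero _)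

/-- Evaluation at `k^d` embeds the Hom space into the linear maps between two finite-dimensional
spaces. -/
instance (F : PolyFunctor k d) (G : SuperPolyFunctor k (d * p ^ r)) :
    Module.Finite k ((frobPrecomp k p d r hp hr).obj F ⟶ G) := by
  let ev : ((frobPrecomp k p d r hp hr).obj F ⟶ G) →ₗ[k]
      (((frobPrecomp k p d r hp hr).obj F).obj (evenStd k d) →ₗ[k] G.obj (evenStd k d)) :=
    { toFun := fun η => η.1 (evenStd k d)
      map_add' := fun _ _ => rfl
      map_smul' := fun _ _ => rfl }
  exact Module.Finite.of_injective ev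
    ((injective_iff_map_eq_zero ev).2 fun η hη => frobTwist_hom_eq_zero (hp := hp) (hr := hr) η hη)

/-! ### Construction of the right adjoint -/

/-- A coordinate space of the dimension of `Hom((Γ^{d,V})₀^{(r)}, G)`. -/
noncomputable abbrev adjointObj (G : SuperPolyFunctor k (d * p ^ r)) (V : FGModuleCat.{u} k) :
    FGModuleCat.{u} k :=
  -- The Hom space consists of families indexed by all super spaces, so it lies in a larger universe
  -- than the values of a `PolyFunctor`. A coordinate space of the same dimension replaces it.
  FGModuleCat.of k (Fin (Module.finrank k
    ((frobPrecomp k p d r hp hr).obj (PolyFunctor.divPow d V) ⟶ G)) → k)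

/-- The identification of `adjointObj` with `Hom((Γ^{d,V})₀^{(r)}, G)`. -/
noncomputable def adjointEquiv (G : SuperPolyFunctor k (d * p ^ r)) (V : FGModuleCat.{u} k) :
    adjointObj p r hp hr G V ≃ₗ[k]
      ((frobPrecomp k p d r hp hr).obj (PolyFunctor.divPow d V) ⟶ G) :=
  (Module.finBasis k
    ((frobPrecomp k p d r hp hr).obj (PolyFunctor.divPow d V) ⟶ G)).equivFun.symm

/-- Precomposition with the twist of the maps `Γ^{d,W} → Γ^{d,V}`. -/
noncomputable def divPowPrecomp (G : SuperPolyFunctor k (d * p ^ r)) (V W : FGModuleCat.{u} k) :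
    GammaHom k d V W →ₗ[k]
      ((frobPrecomp k p d r hp hr).obj (PolyFunctor.divPow d V) ⟶ G) →ₗ[k]
        ((frobPrecomp k p d r hp hr).obj (PolyFunctor.divPow d W) ⟶ G) :=
  LinearMap.mk₂ k (fun f η => (frobPrecomp k p d r hp hr).map (PolyFunctor.divPowMap f) ≫ η)
    (fun _ _ η => Subtype.ext (funext fun X => LinearMap.ext fun _ =>
      (congrArg (η.1 X) (Subtype.ext (LinearMap.comp_add _ _ _))).trans (map_add (η.1 X) _ _)))
    (fun _ _ η => Subtype.ext (funext fun X => LinearMap.ext fun _ =>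
      (congrArg (η.1 X) (Subtype.ext (LinearMap.comp_smul _ _ _))).trans (map_smul (η.1 X) _ _)))
    (fun _ _ _ => Preadditive.comp_add _ _ _ _ _ _)
    (fun _ _ _ => Linear.comp_smul _ _ _ _ _ _)

theorem divPowPrecomp_id (G : SuperPolyFunctor k (d * p ^ r)) (V : FGModuleCat.{u} k)
    (η : (frobPrecomp k p d r hp hr).obj (PolyFunctor.divPow d V) ⟶ G) :
    divPowPrecomp p r hp hr G V V (GammaHom.id k d V) η = η :=
  rfl

/-- Both `V ↦ Γ^{d,V}` and `Hom(-, G)` reverse arrows, so the composite is covariant in `V`. -/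
theorem divPowPrecomp_comp (G : SuperPolyFunctor k (d * p ^ r)) {U V W : FGModuleCat.{u} k}
    (g : GammaHom k d V W) (f : GammaHom k d U V)
    (η : (frobPrecomp k p d r hp hr).obj (PolyFunctor.divPow d U) ⟶ G) :
    divPowPrecomp p r hp hr G U W (GammaHom.comp g f) η =
      divPowPrecomp p r hp hr G V W g (divPowPrecomp p r hp hr G U V f η) :=
  rfl

/-- The strict polynomial functor `V ↦ Hom((Γ^{d,V})₀^{(r)}, G)`. -/
noncomputable def adjointFunctor (G : SuperPolyFunctor k (d * p ^ r)) : PolyFunctor k d where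
  obj V := adjointObj p r hp hr G V
  map {V W} :=
    LinearMap.mk₂ k (fun f x => (adjointEquiv p r hp hr G W).symm
        (divPowPrecomp p r hp hr G V W f (adjointEquiv p r hp hr G V x)))
      (fun _ _ _ => by rw [map_add, LinearMap.add_apply, map_add])
      (fun _ _ _ => by rw [map_smul, LinearMap.smul_apply, map_smul])
      (fun _ _ _ => by rw [map_add, map_add, map_add])
      (fun _ _ _ => by rw [map_smul, map_smul, map_smul])
  map_id V := LinearMap.ext fun x => (LinearEquiv.symm_apply_eq (adjointEquiv p r hp hr G V)).2
    (divPowPrecomp_id p r hp hr G V _)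
  map_comp {U V W} g f := LinearMap.ext fun x => congrArg (adjointEquiv p r hp hr G W).symm
    ((divPowPrecomp_comp p r hp hr G g f _).trans
      (congrArg _ (LinearEquiv.apply_symm_apply (adjointEquiv p r hp hr G V) _).symm))

theorem adjointEquiv_map (G : SuperPolyFunctor k (d * p ^ r)) {V W : FGModuleCat.{u} k}
    (f : GammaHom k d V W) (x : adjointObj p r hp hr G V) :
    adjointEquiv p r hp hr G W ((adjointFunctor p r hp hr G).map f x) =
      (frobPrecomp k p d r hp hr).map (PolyFunctor.divPowMap f) ≫ adjointEquiv p r hp hr G V x :=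
  LinearEquiv.apply_symm_apply _ _

/-- The right adjoint of `frobPrecomp`. -/
noncomputable def frobAdjoint (k : Type u) [Field k] (p : ℕ) [Fact p.Prime] [CharP k p] (d r : ℕ)
    (hp : p ≠ 2) (hr : r ≠ 0) : SuperPolyFunctor k (d * p ^ r) ⥤ PolyFunctor k d where
  obj G := adjointFunctor p r hp hr G
  map {G H} η :=
    { app := fun V => (adjointEquiv p r hp hr H V).symm.toLinearMap ∘ₗ
        Linear.rightComp k _ η ∘ₗ (adjointEquiv p r hp hr G V).toLinearMap
      naturality := fun {V W} f => LinearMap.ext fun x =>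
        (adjointEquiv p r hp hr H W).injective <| by
          refine (adjointEquiv_map p r hp hr H f _).trans ?_
          refine (congrArg _ (LinearEquiv.apply_symm_apply _ _)).trans ?_
          refine Eq.trans ?_ (LinearEquiv.apply_symm_apply (adjointEquiv p r hp hr H W) _).symm
          refine Eq.trans ?_ (congrArg (· ≫ η) (adjointEquiv_map p r hp hr G f x).symm)
          exact (Category.assoc _ _ _).symm }
  map_id G := PolyFunctor.Hom.ext <| funext fun V => LinearMap.ext fun x =>
    (LinearEquiv.symm_apply_eq (adjointEquiv p r hp hr G V)).2
      (Category.comp_id (adjointEquiv p r hp hr G V x))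
  map_comp {G H K} η θ := PolyFunctor.Hom.ext <| funext fun V => LinearMap.ext fun x =>
    congrArg (adjointEquiv p r hp hr K V).symm
      ((Category.assoc (adjointEquiv p r hp hr G V x) η θ).symm.trans
        (congrArg (· ≫ θ) (LinearEquiv.apply_symm_apply (adjointEquiv p r hp hr H V) _).symm))

theorem adjointEquiv_frobAdjoint_map {G H : SuperPolyFunctor k (d * p ^ r)} (η : G ⟶ H)
    (V : FGModuleCat.{u} k) (x : adjointObj p r hp hr G V) :
    adjointEquiv p r hp hr H V (((frobAdjoint k p d r hp hr).map η).app V x) =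
      adjointEquiv p r hp hr G V x ≫ η :=
  LinearEquiv.apply_symm_apply _ _

/-! ### The Yoneda correspondence and the adjunction -/

/-- The Yoneda map: the transformation `Γ^{d,V} → F` given by an element of `F(V)`. -/
noncomputable def PolyFunctor.yoneda (F : PolyFunctor k d) (V : FGModuleCat.{u} k) (x : F.obj V) :
    PolyFunctor.divPow d V ⟶ F where
  app W := (F.map (V := V) (W := W)).flip x
  naturality g := LinearMap.ext fun f => (LinearMap.congr_fun (F.map_comp g f) x).symm

/-- Both sides send `g` to `F(g ∘ f) x`. This makes the transpose of `α` natural in `V`. -/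
theorem PolyFunctor.yoneda_map (F : PolyFunctor k d) {V W : FGModuleCat.{u} k}
    (f : GammaHom k d V W) (x : F.obj V) :
    PolyFunctor.yoneda F W (F.map f x) = PolyFunctor.divPowMap f ≫ PolyFunctor.yoneda F V x :=
  PolyFunctor.Hom.ext <| funext fun _ => LinearMap.ext fun g =>
    (LinearMap.congr_fun (F.map_comp g f) x).symm

/-- `x ↦ (yoneda x)₀^{(r)} ≫ α`, as a linear map. -/
noncomputable def yonedaComp {F : PolyFunctor k d} {G : SuperPolyFunctor k (d * p ^ r)}
    (α : (frobPrecomp k p d r hp hr).obj F ⟶ G) (V : FGModuleCat.{u} k) :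
    F.obj V →ₗ[k] ((frobPrecomp k p d r hp hr).obj (PolyFunctor.divPow d V) ⟶ G) where
  toFun x := (frobPrecomp k p d r hp hr).map (PolyFunctor.yoneda F V x) ≫ α
  map_add' x y := Subtype.ext <| funext fun W => LinearMap.ext fun g =>
    (congrArg (α.1 W) (map_add (F.map (V := V) (W := evenTwist p r W) g) x y)).trans
      (map_add (α.1 W) _ _)
  map_smul' c x := Subtype.ext <| funext fun W => LinearMap.ext fun g =>
    (congrArg (α.1 W) (map_smul (F.map (V := V) (W := evenTwist p r W) g) c x)).trans
      (map_smul (α.1 W) _ _)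

/-- Naturality of `β : F → ρ(G)`, evaluated at a morphism `g` into a Frobenius twist. -/
theorem eval_hom_frobAdjoint {F : PolyFunctor k d} {G : SuperPolyFunctor k (d * p ^ r)}
    (β : F ⟶ (frobAdjoint k p d r hp hr).obj G) {V : FGModuleCat.{u} k} {W : SuperSpace k}
    (g : GammaHom k d V (evenTwist p r W)) (x : F.obj V) :
    (adjointEquiv p r hp hr G (evenTwist p r W) (β.app (evenTwist p r W)
      (F.map (V := V) (W := evenTwist p r W) g x))).1 W (GammaHom.id k d (evenTwist p r W)) =
      (adjointEquiv p r hp hr G V (β.app V x)).1 W g := by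
  -- By naturality of `β`, applying `F(g)` to `x` amounts to precomposing `β x` with `g`; evaluating
  -- at the identity then yields the value of `β x` at `g`.
  have h : (adjointFunctor p r hp hr G).map (V := V) (W := evenTwist p r W) g (β.app V x) =
      β.app (evenTwist p r W) (F.map (V := V) (W := evenTwist p r W) g x) :=
    LinearMap.congr_fun (β.naturality (V := V) (W := evenTwist p r W) g) x
  refine (congrArg (fun y => (adjointEquiv p r hp hr G (evenTwist p r W) y).1 W
    (GammaHom.id k d (evenTwist p r W))) h).symm.trans ?_
  exact LinearMap.congr_fun (congrFun (congrArg Subtype.val (adjointEquiv_map p r hp hr G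
    (V := V) (W := evenTwist p r W) g _)) W) _

/-- The component at `V` of the morphism `F₀^{(r)} → G` corresponding to `β : F → ρ(G)`: an element
`x` of `F(V₀^{(r)})` is sent to the value of `β x` at the identity of `V₀^{(r)}`. -/
noncomputable def evalId {F : PolyFunctor k d} {G : SuperPolyFunctor k (d * p ^ r)}
    (β : F ⟶ (frobAdjoint k p d r hp hr).obj G) (V : SuperSpace k) :
    F.obj (evenTwist p r V) →ₗ[k] G.obj V where
  toFun x := (adjointEquiv p r hp hr G (evenTwist p r V)
    (β.app (evenTwist p r V) x)).1 V (GammaHom.id k d (evenTwist p r V))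
  map_add' x y := by
    rw [map_add]
    exact congrArg (fun η => η.1 V (GammaHom.id k d (evenTwist p r V)))
      (map_add (adjointEquiv p r hp hr G (evenTwist p r V)) _ _)
  map_smul' c x := by
    rw [map_smul]
    exact congrArg (fun η => η.1 V (GammaHom.id k d (evenTwist p r V)))
      (map_smul (adjointEquiv p r hp hr G (evenTwist p r V)) _ _)

/-- The bijection `Hom(F₀^{(r)}, G) ≃ Hom(F, ρ(G))`. -/
noncomputable def frobHomEquiv (F : PolyFunctor k d) (G : SuperPolyFunctor k (d * p ^ r)) :
    ((frobPrecomp k p d r hp hr).obj F ⟶ G) ≃ (F ⟶ (frobAdjoint k p d r hp hr).obj G) where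
  toFun α :=
    { app := fun V => (adjointEquiv p r hp hr G V).symm.toLinearMap ∘ₗ yonedaComp p r hp hr α V
      naturality := fun {V W} f => LinearMap.ext fun x =>
        (adjointEquiv p r hp hr G W).injective <| by
          refine (adjointEquiv_map p r hp hr G f _).trans ?_
          refine (congrArg _ (LinearEquiv.apply_symm_apply _ _)).trans ?_
          refine Eq.trans ?_ (LinearEquiv.apply_symm_apply (adjointEquiv p r hp hr G W) _).symm
          change _ = (frobPrecomp k p d r hp hr).map (PolyFunctor.yoneda F W (F.map f x)) ≫ α
          rw [PolyFunctor.yoneda_map, Functor.map_comp, Category.assoc]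
          rfl }
  invFun β := ⟨evalId p r hp hr β,
    -- Naturality of the transformation `β x` moves `f` past the evaluation and turns the identity
    -- into `frobGamma f`; `eval_hom_frobAdjoint` then absorbs `frobGamma f` into the element `x`.
    (SuperPolyFunctor.mem_homSpace_iff (frobTwist_grade p r hp hr F)).2 fun V W _ f hf =>
      LinearMap.ext fun x => (frobTwist_naturality (adjointEquiv p r hp hr G (evenTwist p r V)
        (β.app (evenTwist p r V) x)) hf (GammaHom.id k d _)).trans
          (eval_hom_frobAdjoint p r hp hr β (V := evenTwist p r V) (frobGamma p r d V W f) x).symm⟩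
  left_inv α := Subtype.ext <| funext fun V => LinearMap.ext fun x => by
    change (adjointEquiv p r hp hr G (evenTwist p r V)
      ((adjointEquiv p r hp hr G (evenTwist p r V)).symm
        (yonedaComp p r hp hr α (evenTwist p r V) x))).1 V (GammaHom.id k d _) = _
    rw [LinearEquiv.apply_symm_apply]
    -- The Yoneda transformation of `x` takes the identity to `F(id) x = x`.
    exact congrArg (α.1 V) (LinearMap.congr_fun (F.map_id (evenTwist p r V)) x)
  right_inv β := PolyFunctor.Hom.ext <| funext fun V => LinearMap.ext fun x =>
    (LinearEquiv.symm_apply_eq (adjointEquiv p r hp hr G V)).2 <|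
      Subtype.ext <| funext fun W => LinearMap.ext fun g =>
        eval_hom_frobAdjoint p r hp hr β g x

/-- The adjunction between precomposition with the even Frobenius twist and `frobAdjoint`. -/
noncomputable def frobAdjunction (k : Type u) [Field k] (p : ℕ) [Fact p.Prime] [CharP k p]
    (d r : ℕ) (hp : p ≠ 2) (hr : r ≠ 0) :
    frobPrecomp k p d r hp hr ⊣ frobAdjoint k p d r hp hr :=
  Adjunction.mkOfHomEquiv
    { homEquiv := frobHomEquiv p r hp hr
      homEquiv_naturality_left_symm := fun _ _ => rfl
      homEquiv_naturality_right := fun {F G H} α η =>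
        PolyFunctor.Hom.ext <| funext fun V => LinearMap.ext fun x =>
          (LinearEquiv.symm_apply_eq (adjointEquiv p r hp hr H V)).2 <| by
            refine Eq.trans ?_ (adjointEquiv_frobAdjoint_map p r hp hr η V _).symm
            refine Eq.trans ?_ (congrArg (· ≫ η) (LinearEquiv.apply_symm_apply _ _).symm)
            exact (Category.assoc ((frobPrecomp k p d r hp hr).map
              (PolyFunctor.yoneda F V x)) α η).symm }

end RightAdjoint

end StrictPoly

theorem proposition3p2 {k : Type u} [Field k] (p : ℕ) [Fact p.Prime] [CharP k p] (hp : p ≠ 2)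
    (d r : ℕ) (hr : r ≠ 0) :
    -- the functor `- ∘ I₀^{(r)}` is exact (exactness of sequences of functors is pointwise)
    (∀ (F' F F'' : StrictPoly.PolyFunctor k d) (α : F' ⟶ F) (β : F ⟶ F''),
      (∀ V, Function.Exact (α.app V) (β.app V)) →
        ∀ V, Function.Exact
          (StrictPoly.SuperPolyFunctor.app ((StrictPoly.frobPrecomp k p d r hp hr).map α) V)
          (StrictPoly.SuperPolyFunctor.app ((StrictPoly.frobPrecomp k p d r hp hr).map β) V)) ∧
    -- it has a right adjoint `ρ`
    ∃ ρ : StrictPoly.SuperPolyFunctor k (d * p ^ r) ⥤ StrictPoly.PolyFunctor k d,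
      Nonempty (StrictPoly.frobPrecomp k p d r hp hr ⊣ ρ) ∧
      -- and `ρ(G)(V)` is `Hom((Γ^{d,V})₀^{(r)}, G)`,
      ∃ e : ∀ (G : StrictPoly.SuperPolyFunctor k (d * p ^ r)) (V : FGModuleCat.{u} k),
          (ρ.obj G).obj V ≃ₗ[k]
            ((StrictPoly.frobPrecomp k p d r hp hr).obj (StrictPoly.PolyFunctor.divPow d V) ⟶ G),
        -- as strict polynomial functors of `V`
        (∀ (G : StrictPoly.SuperPolyFunctor k (d * p ^ r)) (V W : FGModuleCat.{u} k)
          (f : StrictPoly.GammaHom k d V W) (x : (ρ.obj G).obj V),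
          e G W ((ρ.obj G).map f x) =
            (StrictPoly.frobPrecomp k p d r hp hr).map (StrictPoly.PolyFunctor.divPowMap f) ≫
              e G V x) ∧
        -- and functorially in `G`
        (∀ (G H : StrictPoly.SuperPolyFunctor k (d * p ^ r)) (η : G ⟶ H) (V : FGModuleCat.{u} k)
          (x : (ρ.obj G).obj V),
          e H V ((ρ.map η).app V x) = e G V x ≫ η) := by
  -- Exactness of the twisted sequence at `V` is by definition exactness of the original one at
  -- `V₀^{(r)}`.
  exact ⟨fun _ _ _ _ _ h V => h _, StrictPoly.frobAdjoint k p d r hp hr,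
    ⟨StrictPoly.frobAdjunction k p d r hp hr⟩, StrictPoly.adjointEquiv p r hp hr,
    fun G _ _ f x => StrictPoly.adjointEquiv_map p r hp hr G f x,
    fun _ _ η V x => StrictPoly.adjointEquiv_frobAdjoint_map p r hp hr η V x⟩
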